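/- Consider a stable $GI/GI/1$ queue: service times $\sigma^H_1,\sigma^H_2,\dots\ge 0$ are i.i.d. with distribution $H$ and mean $b_H\in(0,\infty)$, interarrival times $t_1,t_2,\dots\ge 0$ are i.i.d. with mean $a\in(0,\infty)$, the two sequences are independent, and $\rho=b_H/a<1$. The first customer arrives at time $0$ and finds the system empty, and $t_n$ is the time between the arrivals of the $n$th and the $(n+1)$st customer. Let $B$ be the duration of the first busy period (the time from $0$ until the first departure that leaves the system empty, an arrival at that very instant being counted as the start of a new busy period), and let $\tau^H=\min\{n\ge 1:\sum_{i=1}^n(\sigma^H_i-t_i)\le 0\}$ be the number of customers served in it. Suppose that $H$ is intermediate regularly varying ($H\in\mathcal{IRV}$): its tail $\overline H(x)=H((x,\infty))$ is positive for all $x$ and $\lim_{\alpha\downarrow 1}\liminf_{x\to\infty}\overline H(\alpha x)/\overline H(x)=1$. Then $\mathbb E\tau^H<\infty$ and, as $x\to\infty$, $$\mathbb P(B>x)\sim\sum_{n\ge 1}\mathbb P(\tau^H\ge n)\,\mathbb P(\sigma^H_n>x(1-\rho))=\mathbb E\tau^H\;\mathbb P(\sigma^H_1>x(1-\rho)).$$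 For every $\varepsilon\in(0,1)$ one can choose an integer $N=N(\varepsilon)\ge 1$ such that, as $x\to\infty$, $$\mathbb P(B>x)\gtrsim\sum_{n=1}^N\mathbb P(\tau^H\ge n,\ \sigma^H_n\ge x(1-\rho))\gtrsim(1-\varepsilon)\,\mathbb P(B>x).$$ Furthermore, $$\{B>x\}\simeq\bigcup_{n\ge 1}\{\tau^H\ge n,\ \sigma^H_n>x(1-\rho)\},\qquad x\to\infty.$$ Here $f\sim g$ means $f(x)/g(x)\to 1$, $f\gtrsim g$ means $\liminf_{x\to\infty}f(x)/g(x)\ge 1$, and, for events $A_x,C_x$ of non-zero probability, $A_x\simeq C_x$ means $\mathbb P(A_x\,\Delta\,C_x)=o(\mathbb P(A_x))$ as $x\to\infty$. -/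

import Mathlib

open MeasureTheory ProbabilityTheory Filter Topology Asymptotics
open scoped ENNReal

namespace GIGI1

/-- The tail `x ↦ μ (x, ∞)` of a distribution `μ` on the real line. -/
noncomputable def tail (μ : Measure ℝ) (x : ℝ) : ℝ := μ.real (Set.Ioi x)

/-- Intermediate regularly varying distributions: the tail is positive everywhere and
`lim_{α ↓ 1} liminf_{x → ∞} tail (α x) / tail x = 1`. For `x > 0` and `α > 1` the ratio lies in
`[0, 1]`, so the real `liminf` is a genuine one. -/
def IsIRV (μ : Measure ℝ) : Prop :=
  (∀ x : ℝ, 0 < tail μ x) ∧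
    Tendsto (fun α : ℝ => liminf (fun x : ℝ => tail μ (α * x) / tail μ x) atTop) (𝓝[>] 1) (𝓝 1)

/-- `f(x) ≳ g(x)` as `x → ∞`: `liminf_{x → ∞} f x / g x ≥ 1` (taken in the extended reals). -/
def AsympGE (f g : ℝ → ℝ) : Prop :=
  1 ≤ liminf (fun x : ℝ => ((f x / g x : ℝ) : EReal)) atTop

/-- Equivalence `A x ≃ B x` of two families of events of non-zero probabilities:
`P (A x ∆ B x) = o (P (A x))` as `x → ∞`. -/
def EventEquiv {Ω : Type*} [MeasurableSpace Ω] (P : Measure Ω) (A B : ℝ → Set Ω) : Prop :=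
  (∀ x, P (A x) ≠ 0) ∧ (∀ x, P (B x) ≠ 0) ∧
    (fun x => P.real (symmDiff (A x) (B x))) =o[atTop] (fun x => P.real (A x))

/-- The input of a stable `GI/GI/1` queue. Customers are numbered `0, 1, 2, …`; customer `n` has
service time `σ n`, and `t n` is the time between the arrivals of customers `n` and `n + 1`. -/
structure IsStableQueue {Ω : Type*} [MeasurableSpace Ω] (P : Measure Ω)
    (t σ : ℕ → Ω → ℝ) : Prop where
  measurable_t : ∀ n, Measurable (t n)
  measurable_σ : ∀ n, Measurable (σ n)
  t_nonneg : ∀ n, ∀ᵐ ω ∂P, 0 ≤ t n ω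
  σ_nonneg : ∀ n, ∀ᵐ ω ∂P, 0 ≤ σ n ω
  /-- all service times and all interarrival times are mutually independent -/
  indep : iIndepFun (Sum.elim σ t : ℕ ⊕ ℕ → Ω → ℝ) P
  identDistrib_t : ∀ n, IdentDistrib (t n) (t 0) P P
  identDistrib_σ : ∀ n, IdentDistrib (σ n) (σ 0) P P
  integrable_t : Integrable (t 0) P
  integrable_σ : Integrable (σ 0) P
  mean_t_pos : 0 < ∫ ω, t 0 ω ∂P
  mean_σ_pos : 0 < ∫ ω, σ 0 ω ∂P
  stable : (∫ ω, σ 0 ω ∂P) / (∫ ω, t 0 ω ∂P) < 1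

/-- The traffic intensity `ρ`: mean service time over mean interarrival time. -/
noncomputable def rho {Ω : Type*} [MeasurableSpace Ω] (P : Measure Ω) (t σ : ℕ → Ω → ℝ) : ℝ :=
  (∫ ω, σ 0 ω ∂P) / (∫ ω, t 0 ω ∂P)

/-- The random walk `S n = ∑_{i < n} (σ i - t i)`, the sum of the first `n` increments. -/
def walk {Ω : Type*} (t σ : ℕ → Ω → ℝ) (n : ℕ) (ω : Ω) : ℝ :=
  ∑ i ∈ Finset.range n, (σ i ω - t i ω)

/-- The number of customers served in the first busy period, `min {n ≥ 1 : S n ≤ 0}`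
(with value `∞` if there is no such `n`). -/
noncomputable def numServed {Ω : Type*} (t σ : ℕ → Ω → ℝ) (ω : Ω) : ℕ∞ :=
  ⨅ (n : ℕ) (_ : 1 ≤ n ∧ walk t σ n ω ≤ 0), (n : ℕ∞)

/-- The arrival instant of customer `n`; customer `0` arrives at time `0` at an empty system. -/
def arrival {Ω : Type*} (t : ℕ → Ω → ℝ) (n : ℕ) (ω : Ω) : ℝ :=
  ∑ i ∈ Finset.range n, t i ω

/-- The departure instant of customer `n` under first-come-first-served: service starts at the
arrival, or at the departure of the previous customer if that is later. -/
noncomputable def departure {Ω : Type*} (t σ : ℕ → Ω → ℝ) : ℕ → Ω → ℝ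
  | 0, ω => σ 0 ω
  | n + 1, ω => max (departure t σ n ω) (arrival t (n + 1) ω) + σ (n + 1) ω

/-- The length of the first busy period. It starts at time `0` with the arrival of customer `0`,
and ends at the first departure that leaves the system empty, that is, the first departure of a
customer `n` that is not later than the arrival of customer `n + 1`. (An arrival at that very
instant opens a new busy period. The value is `∞` if the system never becomes empty.) -/
noncomputable def busyPeriod {Ω : Type*} (t σ : ℕ → Ω → ℝ) (ω : Ω) : EReal :=
  ⨅ (n : ℕ) (_ : departure t σ n ω ≤ arrival t (n + 1) ω), (departure t σ n ω : EReal)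

end GIGI1

/-!
A busy period is longer than `x` essentially only because of one customer with a service time of
order `x`. Write `a`, `b` for the mean interarrival and service times, `ρ = b / a`, `S` for the walk
of the queue, `τ` for the number of customers served, `H` for the distribution of a service time,
and `x ↦ tail H x` for its tail. By `busyPeriod_eq`, `B` is the sum of the first `τ` service times.

* If a customer of the busy period has a service time `y` of order `x` and everybody else behaves as
  the law of large numbers predicts, then `B` is about `y / (1 - ρ)`. Hence a long busy period with a
  large service time, or the reverse, without the other, needs a service time within a small
  factor of `(1 - ρ) x`, which intermediate regular variation makes improbable, or an independent
  deviation from the law of large numbers (`busyPeriod_le_of_small`, `lt_busyPeriod_of_large`,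
  `tendsto_prob_deviation`).

* Busy periods longer than `x` in which no service time is of order `x` have probability
  `o (tail H x)` (`prob_no_big_jump`). No moment beyond the mean is available, so exponential
  inequalities for truncated sums do not suffice. Instead, inflate the service times by a factor
  `l > 1` that keeps the drift negative, and truncate the interarrival times. Along a busy period
  longer than `x` the new walk is nonnegative and exceeds a multiple of `x`. With
  `G y = E (l σ - y)⁺`, the function `s ↦ min 1 (K G (x - s))` is superharmonic for this walk where
  it is below `1` (`exists_excess_drift`). Optional stopping at the end of the excursion bounds
  the probability that an excursion reaches `x` by `2 K (G x - G (x + A))`, which is `O (tail H x)`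
  (`prob_excursion_gt_le`). An excursion reaching `3 z` by steps at most `z` must land in `(z, 2 z]`
  and then climb by another `z`, which costs an additional factor `K G z → 0`
  (`prob_excursion_no_big_step_le`).

* `E τ < ∞` since the truncated walk has negative drift and bounded downward steps
  (`sum_prob_nonneg_le`). The event that customer `n` is served in the busy period depends on earlier
  customers only, so it is independent of the service time of customer `n`; with a Bonferroni
  bound, `P (⋃ n, {n < τ, σ n > y}) ∼ E τ · tail H y` (`bigService_sub_isLittleO`).

The symmetric difference of the two events is thus negligible (`symmDiff_isLittleO`), and the
statements about `P (B > x)` follow.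
-/

namespace GIGI1

/-! ### Intermediate regularly varying tails -/

lemma tail_antitone (μ : Measure ℝ) [IsFiniteMeasure μ] : Antitone (tail μ) :=
  fun _ _ h => measureReal_mono (Set.Ioi_subset_Ioi h)

lemma tail_nonneg (μ : Measure ℝ) (x : ℝ) : 0 ≤ tail μ x := measureReal_nonneg

section IRV

variable {μ : Measure ℝ}

lemma IsIRV.exists_scale (h : IsIRV μ) {ε : ℝ} (hε : 0 < ε) :
    ∃ α : ℝ, 1 < α ∧ ∀ᶠ x in atTop, (1 - ε) * tail μ x ≤ tail μ (α * x) := by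
  have h1 := h.2.eventually (lt_mem_nhds (show 1 - ε < 1 by linarith))
  obtain ⟨α, hα, hα1⟩ := (h1.and self_mem_nhdsWithin).exists
  refine ⟨α, hα1, ?_⟩
  have hb : IsBoundedUnder (· ≥ ·) atTop (fun x : ℝ => tail μ (α * x) / tail μ x) :=
    isBoundedUnder_of ⟨0, fun x => div_nonneg (tail_nonneg _ _) (tail_nonneg _ _)⟩
  filter_upwards [eventually_lt_of_lt_liminf hα hb] with x hx
  exact ((lt_div_iff₀ (h.1 x)).1 hx).le

variable [IsProbabilityMeasure μ]

/-- Intermediate regularly varying tails are of dominated variation. -/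
lemma IsIRV.dominated (h : IsIRV μ) {r : ℝ} (hr : 0 < r) :
    ∃ C : ℝ, 0 < C ∧ ∀ᶠ x in atTop, tail μ (r * x) ≤ C * tail μ x := by
  obtain ⟨α, hα, hev⟩ := h.exists_scale (ε := 1 / 2) (by norm_num)
  have hα0 : 0 < α := by linarith
  have key : ∀ k : ℕ, ∀ᶠ x in atTop, tail μ x ≤ 2 ^ k * tail μ (α ^ k * x) := by
    intro k
    induction k with
    | zero => simp
    | succ k ih =>
      have h2 : Tendsto (fun x : ℝ => α ^ k * x) atTop atTop :=
        tendsto_id.const_mul_atTop (by positivity)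
      filter_upwards [ih, h2.eventually hev] with x h3 h4
      have h5 : tail μ (α ^ k * x) ≤ 2 * tail μ (α ^ (k + 1) * x) := by
        have : α ^ (k + 1) * x = α * (α ^ k * x) := by ring
        rw [this]; linarith
      calc tail μ x ≤ 2 ^ k * tail μ (α ^ k * x) := h3
        _ ≤ 2 ^ k * (2 * tail μ (α ^ (k + 1) * x)) := by gcongr
        _ = _ := by ring
  obtain ⟨k, hk⟩ := pow_unbounded_of_one_lt (1 / r) hα
  refine ⟨2 ^ k, by positivity, ?_⟩
  have h2 : Tendsto (fun x : ℝ => r * x) atTop atTop := tendsto_id.const_mul_atTop hr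
  filter_upwards [h2.eventually (key k), eventually_ge_atTop 0] with x hx hx0
  refine hx.trans ?_
  gcongr
  apply tail_antitone μ
  have h3 : 1 ≤ α ^ k * r := by
    rw [div_lt_iff₀ hr] at hk; exact hk.le
  nlinarith

/-- Intermediate regularly varying tails are long-tailed. -/
lemma IsIRV.shift (h : IsIRV μ) (L : ℝ) {ε : ℝ} (hε : 0 < ε) :
    ∀ᶠ x in atTop, tail μ (x - L) ≤ (1 + ε) * tail μ x := by
  obtain ⟨α, hα, hev⟩ := h.exists_scale (ε := ε / (1 + ε)) (by positivity)
  have h2 : Tendsto (fun x : ℝ => x - L) atTop atTop := tendsto_atTop_add_const_right _ _ tendsto_id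
  filter_upwards [h2.eventually hev, eventually_ge_atTop (α * L / (α - 1))] with x hx hx1
  have h3 : tail μ (α * (x - L)) ≤ tail μ x := by
    apply tail_antitone μ
    rw [div_le_iff₀ (by linarith)] at hx1
    linarith
  have h4 : 1 - ε / (1 + ε) = 1 / (1 + ε) := by field_simp; ring
  rw [h4] at hx
  have h5 := hx.trans h3
  rw [div_mul_eq_mul_div, one_mul, div_le_iff₀ (by positivity)] at h5
  linarith

/-- Contracting the argument by a factor close to `1` increases an intermediate regularly varying
tail by a small relative amount. -/
lemma IsIRV.exists_contraction (h : IsIRV μ) {ε : ℝ} (hε : 0 < ε) :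
    ∃ δ : ℝ, 0 < δ ∧ δ ≤ 1 / 2 ∧ ∀ᶠ x in atTop, tail μ ((1 - δ) * x) ≤ (1 + ε) * tail μ x ∧
      tail μ x ≤ (1 + ε) * tail μ ((1 + δ) * x) := by
  obtain ⟨α, hα, hev⟩ := h.exists_scale (ε := ε / (1 + ε)) (by positivity)
  have hα0 : 0 < α := by linarith
  have h4 : 1 - ε / (1 + ε) = 1 / (1 + ε) := by field_simp; ring
  rw [h4] at hev
  have hev' : ∀ᶠ x in atTop, tail μ x ≤ (1 + ε) * tail μ (α * x) := by
    filter_upwards [hev] with x hx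
    rw [div_mul_eq_mul_div, one_mul, div_le_iff₀ (by positivity)] at hx
    linarith
  have hα1 : 0 < 1 - 1 / α := by
    rw [sub_pos, div_lt_one hα0]; exact hα
  obtain ⟨δ, hδ0, hδ⟩ : ∃ δ, 0 < δ ∧ δ = min (1 / 2) (1 - 1 / α) :=
    ⟨_, lt_min (by norm_num) hα1, rfl⟩
  have hδ2 : δ ≤ 1 / 2 := hδ ▸ min_le_left _ _
  have hδα : δ ≤ 1 - 1 / α := hδ ▸ min_le_right _ _
  have hm : 1 ≤ α * (1 - δ) := by
    have : α * (1 / α) = 1 := by field_simp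
    nlinarith
  have hm2 : 1 + δ ≤ α := by nlinarith
  refine ⟨δ, hδ0, hδ2, ?_⟩
  have h2 : Tendsto (fun x : ℝ => (1 - δ) * x) atTop atTop :=
    tendsto_id.const_mul_atTop (by linarith)
  filter_upwards [h2.eventually hev', hev', eventually_ge_atTop 0] with x h1 h3 hx
  refine ⟨h1.trans ?_, h3.trans ?_⟩
  · gcongr
    apply tail_antitone μ
    nlinarith
  · gcongr
    apply tail_antitone μ
    nlinarith

end IRV

/-! ### The integrated tail as a Lyapunov function -/

section Excess

variable {Ω : Type*} [MeasurableSpace Ω] {P : Measure Ω} {Y : Ω → ℝ}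

/-- The mean excess `E (Y - y)⁺`, that is, the integral of the tail of `Y` over `(y, ∞)`. -/
noncomputable def excess (P : Measure Ω) (Y : Ω → ℝ) (y : ℝ) : ℝ := ∫ ω, max (Y ω - y) 0 ∂P

lemma excess_nonneg (y : ℝ) : 0 ≤ excess P Y y :=
  integral_nonneg fun _ => le_max_right _ _

lemma integral_const_mul_tail (hYm : Measurable Y) (r y : ℝ) :
    ∫ ω, r * ({ω | y < Y ω}.indicator (fun _ => (1 : ℝ)) ω) ∂P = r * P.real {ω | y < Y ω} := by
  rw [integral_const_mul, integral_indicator_const _ (measurableSet_lt measurable_const hYm)]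
  simp

variable [IsProbabilityMeasure P]

lemma integrable_excess (hY : Integrable Y P) (y : ℝ) :
    Integrable (fun ω => max (Y ω - y) 0) P :=
  (hY.sub (integrable_const y)).pos_part

lemma excess_antitone (hY : Integrable Y P) : Antitone (excess P Y) := fun x y hxy =>
  integral_mono (integrable_excess hY y) (integrable_excess hY x) fun ω =>
    max_le_max (by linarith) le_rfl

lemma integrable_const_mul_tail (hYm : Measurable Y) (r y : ℝ) :
    Integrable (fun ω => r * ({ω | y < Y ω}.indicator (fun _ => (1 : ℝ)) ω)) P :=
  ((integrable_const (1 : ℝ)).indicator (measurableSet_lt measurable_const hYm)).const_mul r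

lemma excess_le_add (hYm : Measurable Y) (hY : Integrable Y P) (y r : ℝ) :
    excess P Y y ≤ excess P Y (y + r) + r * P.real {ω | y < Y ω} := by
  rw [← integral_const_mul_tail hYm, excess, excess,
    ← integral_add (integrable_excess hY _) (integrable_const_mul_tail hYm r y)]
  refine integral_mono (integrable_excess hY _)
    ((integrable_excess hY _).add (integrable_const_mul_tail hYm r y)) fun ω => ?_
  by_cases h : y < Y ω
  · simp only [Set.indicator, Set.mem_ofPred_eq, h, if_true]
    rcases max_cases (Y ω - y) 0 with h1 | h1 <;> rcases max_cases (Y ω - (y + r)) 0 with h2 | h2 <;>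
      linarith
  · simp only [Set.indicator, Set.mem_ofPred_eq, h, if_false]
    rw [max_eq_right (by linarith)]
    simp

lemma add_le_excess (hYm : Measurable Y) (hY : Integrable Y P) (y : ℝ) {r : ℝ} (hr : 0 ≤ r) :
    excess P Y (y + r) + r * P.real {ω | y + r < Y ω} ≤ excess P Y y := by
  rw [← integral_const_mul_tail hYm, excess, excess,
    ← integral_add (integrable_excess hY _) (integrable_const_mul_tail hYm r _)]
  refine integral_mono ((integrable_excess hY _).add (integrable_const_mul_tail hYm r _))
    (integrable_excess hY _) fun ω => ?_
  by_cases h : y + r < Y ω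
  · simp only [Set.indicator, Set.mem_ofPred_eq, h, if_true]
    rw [max_eq_left (by linarith), max_eq_left (by linarith)]
    linarith
  · simp only [Set.indicator, Set.mem_ofPred_eq, h, if_false]
    rw [max_eq_right (by linarith)]
    simp

lemma excess_pos (hYm : Measurable Y) (hY : Integrable Y P) (hpos : ∀ y, 0 < P.real {ω | y < Y ω})
    (y : ℝ) : 0 < excess P Y y := by
  have h := add_le_excess (P := P) hYm hY y zero_le_one
  have h1 := hpos (y + 1)
  have h2 : 0 ≤ excess P Y (y + 1) := excess_nonneg _
  linarith

lemma tendsto_excess (hY : Integrable Y P) :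
    Tendsto (excess P Y) atTop (𝓝 0) := by
  have h : Tendsto (fun y => ∫ ω, max (Y ω - y) 0 ∂P) atTop (𝓝 (∫ _, (0 : ℝ) ∂P)) := by
    refine tendsto_integral_filter_of_dominated_convergence (fun ω => |Y ω|) ?_ ?_ hY.abs ?_
    · exact Eventually.of_forall fun y => (integrable_excess hY y).aestronglyMeasurable
    · filter_upwards [eventually_ge_atTop 0] with y hy
      refine Eventually.of_forall fun ω => ?_
      rw [Real.norm_eq_abs, abs_of_nonneg (le_max_right _ _)]
      exact max_le (by linarith [le_abs_self (Y ω)]) (abs_nonneg _)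
    · refine Eventually.of_forall fun ω => ?_
      refine tendsto_const_nhds.congr' ?_
      filter_upwards [eventually_ge_atTop (Y ω)] with y hy
      rw [max_eq_right (by linarith)]
  rw [integral_zero] at h
  exact h

/-- Lyapunov property of the integrated tail. For increments `Y - T` of negative mean, with `T`
bounded and the tail of `Y` long-tailed and of dominated variation, `s ↦ min 1 (K E (Y - (y - s))⁺)`
is superharmonic where it is smaller than `1`: the negative drift lowers it by a
multiple of the tail at `y`, and this pays for a jump beyond `y / 2` once `K` is large. -/
lemma exists_excess_drift {T : Ω → ℝ} {A : ℝ} (hYm : Measurable Y) (hY : Integrable Y P)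
    (hTm : Measurable T) (hY0 : ∀ᵐ ω ∂P, 0 ≤ Y ω) (hT : ∀ᵐ ω ∂P, 0 ≤ T ω ∧ T ω ≤ A)
    (hlt : ∫ ω, Y ω ∂P < ∫ ω, T ω ∂P) (hpos : ∀ y, 0 < P.real {ω | y < Y ω})
    (hshift : ∀ L ε : ℝ, 0 < ε →
      ∀ᶠ y in atTop, P.real {ω | y - L < Y ω} ≤ (1 + ε) * P.real {ω | y < Y ω})
    (hdom : ∃ C : ℝ, 0 < C ∧ ∀ᶠ y in atTop, P.real {ω | 1 / 2 * y < Y ω} ≤ C * P.real {ω | y < Y ω}) :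
    ∃ K : ℝ, 0 < K ∧ 1 ≤ K * excess P Y 0 ∧ ∀ y, K * excess P Y y < 1 →
      ∫ ω, min 1 (K * excess P Y (y - (Y ω - T ω))) ∂P ≤ K * excess P Y y := by
  obtain ⟨C, hC0, hC⟩ := hdom
  have hA : 0 ≤ A := by
    obtain ⟨ω, h1, h2⟩ := hT.exists
    linarith
  have hTi : Integrable T P := by
    refine Integrable.of_bound hTm.aestronglyMeasurable A ?_
    filter_upwards [hT] with ω h
    rw [Real.norm_eq_abs, abs_of_nonneg h.1]
    exact h.2
  set F : ℝ → ℝ := fun y => P.real {ω | y < Y ω} with hF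
  set G := excess P Y with hG
  have hFanti : Antitone F := fun x y hxy =>
    measureReal_mono fun ω (hω : y < Y ω) => lt_of_le_of_lt hxy hω
  set Δ := ∫ ω, T ω ∂P - ∫ ω, Y ω ∂P with hΔ
  have hΔ0 : 0 < Δ := by simp only [hΔ]; linarith
  have hEY : 0 ≤ ∫ ω, Y ω ∂P := integral_nonneg_of_ae hY0
  -- the contribution of `Y` above the level `L` is negligible
  have hbig : Tendsto (fun L : ℝ => ∫ ω, {ω | L < Y ω}.indicator (fun ω => A + C * Y ω) ω ∂P) atTop
      (𝓝 (∫ _, (0 : ℝ) ∂P)) := by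
    refine tendsto_integral_filter_of_dominated_convergence (fun ω => |A + C * Y ω|) ?_ ?_
      ((integrable_const A).add (hY.const_mul C) |>.abs) ?_
    · exact Eventually.of_forall fun L => ((by fun_prop : Measurable fun ω => A + C * Y ω).indicator
        (measurableSet_lt measurable_const hYm)).aestronglyMeasurable
    · exact Eventually.of_forall fun L => Eventually.of_forall fun ω => norm_indicator_le_norm_self _ _
    · refine Eventually.of_forall fun ω => tendsto_const_nhds.congr' ?_
      filter_upwards [eventually_ge_atTop (Y ω)] with L hL
      rw [Set.indicator_of_notMem]
      simpa using hL
  rw [integral_zero] at hbig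
  obtain ⟨L, hL, hL0⟩ := ((hbig.eventually (gt_mem_nhds (show 0 < Δ / 4 by linarith))).and
    (eventually_ge_atTop 0)).exists
  have hEYA : 0 < ∫ ω, Y ω ∂P + A + 1 := by linarith
  set ε := min (1 / 2) (Δ / 4 / (∫ ω, Y ω ∂P + A + 1)) with hε
  have hε0 : 0 < ε := lt_min (by norm_num) (by positivity)
  have hεΔ : ε * (∫ ω, Y ω ∂P + A) ≤ Δ / 4 := by
    have h1 : ε ≤ Δ / 4 / (∫ ω, Y ω ∂P + A + 1) := min_le_right _ _
    rw [le_div_iff₀ hEYA] at h1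
    nlinarith
  obtain ⟨y₀, hy₀⟩ := eventually_atTop.1 ((hshift L ε hε0).and ((((tendsto_atTop_add_const_right
    atTop A tendsto_id).eventually (hshift A ε hε0))).and (hC.and (eventually_ge_atTop (2 * L)))))
  set K := max (4 * C / Δ) (max (1 / G y₀) (1 / G 0)) with hK
  have hK1 : 4 * C / Δ ≤ K := le_max_left _ _
  have hGpos : ∀ y, 0 < G y := excess_pos hYm hY hpos
  have hK2 : 1 ≤ K * G y₀ := by
    rw [← div_le_iff₀ (hGpos _)]; exact (le_max_left _ _).trans (le_max_right _ _)
  have hK3 : 1 ≤ K * G 0 := by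
    rw [← div_le_iff₀ (hGpos _)]; exact (le_max_right _ _).trans (le_max_right _ _)
  have hK0 : 0 < K := lt_of_lt_of_le (by positivity) hK1
  have hCK : C ≤ K * (Δ / 4) := by
    rw [div_le_iff₀ hΔ0] at hK1; linarith
  refine ⟨K, hK0, hK3, fun y hy => ?_⟩
  have hyy : y₀ ≤ y := by
    by_contra! h
    have := excess_antitone (P := P) hY h.le
    have := mul_le_mul_of_nonneg_left this hK0.le
    linarith
  obtain ⟨hs1, hs2, hd, hy2L⟩ := hy₀ y hyy
  simp only [id_eq, add_sub_cancel_right] at hs2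
  change F (y - L) ≤ (1 + ε) * F y at hs1
  change F y ≤ (1 + ε) * F (y + A) at hs2
  change F (1 / 2 * y) ≤ C * F y at hd
  have hFy : 0 < F y := hpos y
  have hs3 : (1 - ε) * F y ≤ F (y + A) := by
    have hε1 : ε ≤ 1 / 2 := min_le_left _ _
    have h1 : 0 < F (y + A) := hpos _
    have h2 := mul_le_mul_of_nonneg_left hs2 (show 0 ≤ 1 - ε by linarith)
    have h3 : 0 ≤ ε * ε * F (y + A) := by positivity
    linarith
  -- pointwise bound, split according to `Y ≤ L`, `L < Y ≤ y / 2` and `y / 2 < Y`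
  have hpt : ∀ᵐ ω ∂P, min 1 (K * G (y - (Y ω - T ω))) ≤ K * G y + K * F y * (Y ω - T ω +
      ε * (Y ω + A) + {ω | L < Y ω}.indicator (fun ω => A + C * Y ω) ω) +
      1 * {ω | 1 / 2 * y < Y ω}.indicator (fun _ => (1 : ℝ)) ω := by
    filter_upwards [hY0, hT] with ω h0 ⟨hT0, hTA⟩
    have hKF : 0 < K * F y := mul_pos hK0 hFy
    have hεY : 0 ≤ ε * (Y ω + A) := by positivity
    by_cases hLY : L < Y ω
    · have hpart : 0 ≤ Y ω - T ω + ε * (Y ω + A) + A := by linarith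
      by_cases hyY : 1 / 2 * y < Y ω
      · simp only [Set.indicator, Set.mem_ofPred_eq, hLY, hyY, if_true]
        have h1 : 0 ≤ K * G y := mul_nonneg hK0.le (hGpos _).le
        have h2 : 0 ≤ Y ω - T ω + ε * (Y ω + A) + (A + C * Y ω) := by
          have : 0 ≤ C * Y ω := by positivity
          linarith
        have h3 := mul_nonneg hKF.le h2
        exact (min_le_left _ _).trans (by linarith)
      · simp only [Set.indicator, Set.mem_ofPred_eq, hLY, hyY, if_true, if_false]
        refine (min_le_right _ _).trans ?_
        have h1 : G (y - (Y ω - T ω)) ≤ G (y - Y ω) := excess_antitone hY (by linarith)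
        have h2 : G (y - Y ω) ≤ G (y - Y ω + Y ω) + Y ω * F (y - Y ω) := excess_le_add hYm hY _ _
        have h3 : F (y - Y ω) ≤ F (1 / 2 * y) := hFanti (by linarith)
        rw [sub_add_cancel] at h2
        have h4 : Y ω * F (y - Y ω) ≤ Y ω * (C * F y) := mul_le_mul_of_nonneg_left (h3.trans hd) h0
        have h5 : K * G (y - (Y ω - T ω)) ≤ K * (G y + Y ω * (C * F y)) := by gcongr; linarith
        have h6 := mul_nonneg hKF.le hpart
        linarith
    · have hyY : ¬ 1 / 2 * y < Y ω := by push Not at hLY ⊢; linarith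
      simp only [Set.indicator, Set.mem_ofPred_eq, hLY, hyY, if_false]
      push Not at hLY
      refine (min_le_right _ _).trans ?_
      have h1 : G (y - (Y ω - T ω)) ≤ G y + F y * (Y ω - T ω + ε * (Y ω + A)) := by
        rcases le_total 0 (Y ω - T ω) with hx | hx
        · have h2 : G (y - (Y ω - T ω)) ≤ G (y - (Y ω - T ω) + (Y ω - T ω)) +
            (Y ω - T ω) * F (y - (Y ω - T ω)) := excess_le_add hYm hY _ _
          rw [sub_add_cancel] at h2
          have h3 : F (y - (Y ω - T ω)) ≤ (1 + ε) * F y := (hFanti (by linarith)).trans hs1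
          have h4 := mul_le_mul_of_nonneg_left h3 hx
          have h5 : 0 ≤ ε * F y * (T ω + A) := by positivity
          linarith
        · have h2 : G (y + (T ω - Y ω)) + (T ω - Y ω) * F (y + (T ω - Y ω)) ≤ G y :=
            add_le_excess hYm hY _ (by linarith)
          rw [show y - (Y ω - T ω) = y + (T ω - Y ω) by ring]
          have h3 : (1 - ε) * F y ≤ F (y + (T ω - Y ω)) := hs3.trans (hFanti (by linarith))
          have h4 := mul_le_mul_of_nonneg_left h3 (show 0 ≤ T ω - Y ω by linarith)
          have h5 : 0 ≤ ε * F y * (A - T ω + 2 * Y ω) := by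
            have : 0 ≤ A - T ω + 2 * Y ω := by linarith
            positivity
          linarith
      have h2 := mul_le_mul_of_nonneg_left h1 hK0.le
      linarith
  have hmeas : Measurable fun ω => min 1 (K * G (y - (Y ω - T ω))) := by
    have : Measurable G := (excess_antitone (P := P) hY).measurable
    fun_prop
  have hlhs : Integrable (fun ω => min 1 (K * G (y - (Y ω - T ω)))) P := by
    refine Integrable.of_bound hmeas.aestronglyMeasurable 1 (Eventually.of_forall fun ω => ?_)
    rw [Real.norm_eq_abs, abs_of_nonneg (le_min zero_le_one (mul_nonneg hK0.le (hGpos _).le))]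
    exact min_le_left _ _
  have hi1 : Integrable (fun ω => Y ω - T ω) P := hY.sub hTi
  have hi2 : Integrable (fun ω => ε * (Y ω + A)) P := (hY.add (integrable_const A)).const_mul ε
  have hi3 : Integrable (fun ω => {ω | L < Y ω}.indicator (fun ω => A + C * Y ω) ω) P :=
    ((integrable_const A).add (hY.const_mul C)).indicator (measurableSet_lt measurable_const hYm)
  have hi4 := integrable_const_mul_tail (P := P) hYm 1 (1 / 2 * y)
  have hi12 : Integrable (fun ω => Y ω - T ω + ε * (Y ω + A)) P := hi1.add hi2
  have hi123 : Integrable (fun ω => Y ω - T ω + ε * (Y ω + A) +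
      {ω | L < Y ω}.indicator (fun ω => A + C * Y ω) ω) P := hi12.add hi3
  have hi5 := hi123.const_mul (K * F y)
  have hi6 : Integrable (fun ω => K * G y + K * F y * (Y ω - T ω + ε * (Y ω + A) +
      {ω | L < Y ω}.indicator (fun ω => A + C * Y ω) ω)) P := (integrable_const _).add hi5
  refine (integral_mono_ae hlhs (hi6.add hi4) hpt).trans ?_
  simp only [Pi.add_apply]
  rw [integral_add hi6 hi4, integral_const_mul_tail hYm, integral_add (integrable_const _) hi5,
    integral_const_mul (K * F y), integral_add hi12 hi3, integral_add hi1 hi2, integral_sub hY hTi,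
    integral_const_mul ε, integral_add hY (integrable_const A)]
  simp only [integral_const, probReal_univ, smul_eq_mul, one_mul]
  change K * G y + K * F y * _ + F (1 / 2 * y) ≤ _
  have hsum : ∫ ω, Y ω ∂P - ∫ ω, T ω ∂P + ε * (∫ ω, Y ω ∂P + A) +
      ∫ ω, {ω | L < Y ω}.indicator (fun ω => A + C * Y ω) ω ∂P ≤ -(Δ / 2) := by linarith
  have h1 := mul_le_mul_of_nonneg_left hsum (mul_pos hK0 hFy).le
  have h2 : C * F y ≤ K * (Δ / 4) * F y := by gcongr
  have h3 : 0 < K * F y * Δ := by positivity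
  linarith

end Excess

/-! ### Excursions of random walks with negative drift -/

section Walk

variable {Ω : Type*}

/-- Partial sums of a sequence of random variables. -/
def psum (ξ : ℕ → Ω → ℝ) (n : ℕ) (ω : Ω) : ℝ := ∑ i ∈ Finset.range n, ξ i ω

@[simp] lemma psum_zero (ξ : ℕ → Ω → ℝ) (ω : Ω) : psum ξ 0 ω = 0 := by simp [psum]

lemma psum_succ (ξ : ℕ → Ω → ℝ) (n : ℕ) (ω : Ω) : psum ξ (n + 1) ω = psum ξ n ω + ξ n ω :=
  Finset.sum_range_succ _ _

lemma psum_add (ξ : ℕ → Ω → ℝ) (k n : ℕ) (ω : Ω) :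
    psum ξ (k + n) ω = psum ξ k ω + psum (fun i => ξ (k + i)) n ω :=
  Finset.sum_range_add _ _ _

/-- The walk with steps `ξ`, started at `0` and frozen as soon as it is outside `C`. -/
noncomputable def absorbed (ξ : ℕ → Ω → ℝ) (C : Set ℝ) : ℕ → Ω → ℝ
  | 0, _ => 0
  | n + 1, ω => absorbed ξ C n ω + C.indicator (fun _ => (1 : ℝ)) (absorbed ξ C n ω) * ξ n ω

lemma absorbed_eq_psum {ξ : ℕ → Ω → ℝ} {C : Set ℝ} {ω : Ω} {n : ℕ}
    (h : ∀ k < n, psum ξ k ω ∈ C) : absorbed ξ C n ω = psum ξ n ω := by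
  induction n with
  | zero => simp [absorbed]
  | succ n ih =>
    have h1 := ih fun k hk => h k (by omega)
    simp [absorbed, h1, psum_succ, Set.indicator_of_mem (h n (by omega))]

lemma absorbed_of_notMem {ξ : ℕ → Ω → ℝ} {C : Set ℝ} {ω : Ω} {n k : ℕ} (hnk : n ≤ k)
    (h : absorbed ξ C n ω ∉ C) : absorbed ξ C k ω = absorbed ξ C n ω := by
  induction k, hnk using Nat.le_induction with
  | base => rfl
  | succ k _ ih => simp [absorbed, ih, Set.indicator_of_notMem h]

lemma exists_absorbed_eq {ξ : ℕ → Ω → ℝ} {C : Set ℝ} {ω : Ω} {n : ℕ}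
    (h : ∃ k ≤ n, psum ξ k ω ∉ C) :
    ∃ k ≤ n, (∀ k', k' ≤ n → psum ξ k' ω ∉ C → k ≤ k') ∧ psum ξ k ω ∉ C ∧
      absorbed ξ C n ω = psum ξ k ω := by
  classical
  have h' : ∃ k, psum ξ k ω ∉ C := by obtain ⟨k, _, hk⟩ := h; exact ⟨k, hk⟩
  have hle : ∀ k', psum ξ k' ω ∉ C → Nat.find h' ≤ k' := fun k' hk' => Nat.find_min' h' hk'
  obtain ⟨k', hk', hk⟩ := h
  have hspec := Nat.find_spec h'
  have heq : absorbed ξ C (Nat.find h') ω = psum ξ (Nat.find h') ω :=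
    absorbed_eq_psum fun j hj => by
      by_contra hj'
      exact absurd (hle j hj') (by omega)
  refine ⟨Nat.find h', (hle k' hk).trans hk', fun k' _ => hle k', hspec, ?_⟩
  rw [absorbed_of_notMem ((hle k' hk).trans hk') (by rwa [heq]), heq]

variable [mΩ : MeasurableSpace Ω]

/-- Independent identically distributed steps `ξ n`, together with σ-algebras `m S`, the
information carried by the indices in `S`: step `n` is `m {n}`-measurable, and disjoint index sets
carry independent information. The family `m` may contain more than the steps themselves. -/
structure IndepSteps (P : Measure Ω) (ξ : ℕ → Ω → ℝ) (m : Set ℕ → MeasurableSpace Ω) : Prop where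
  mono : Monotone m
  le : ∀ S, m S ≤ mΩ
  indep : ∀ S T, Disjoint S T → Indep (m S) (m T) P
  meas : ∀ n, Measurable[m {n}] (ξ n)
  ident : ∀ n, IdentDistrib (ξ n) (ξ 0) P P

variable {P : Measure Ω} {ξ : ℕ → Ω → ℝ} {m : Set ℕ → MeasurableSpace Ω}

namespace IndepSteps

variable (h : IndepSteps P ξ m)
include h

lemma measurable (n : ℕ) : Measurable (ξ n) := (h.meas n).mono (h.le _) le_rfl

lemma measurable_psum_of (n : ℕ) {S : Set ℕ} (hS : Set.Iio n ⊆ S) : Measurable[m S] (psum ξ n) := by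
  refine Finset.measurable_fun_sum _ fun i hi => ?_
  exact (h.meas i).mono (h.mono (by simpa using hS (Finset.mem_range.1 hi))) le_rfl

lemma measurable_psum (n : ℕ) : Measurable (psum ξ n) :=
  (h.measurable_psum_of n subset_rfl).mono (h.le _) le_rfl

lemma measurable_absorbed_of {C : Set ℝ} (hC : MeasurableSet C) (n : ℕ) :
    Measurable[m (Set.Iio n)] (absorbed ξ C n) := by
  induction n with
  | zero => exact measurable_const
  | succ n ih =>
    have h1 : Measurable[m (Set.Iio (n + 1))] (absorbed ξ C n) :=
      ih.mono (h.mono (Set.Iio_subset_Iio (by omega))) le_rfl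
    have h2 : Measurable[m (Set.Iio (n + 1))] (ξ n) :=
      (h.meas n).mono (h.mono (by simp)) le_rfl
    have h3 : Measurable (C.indicator (fun _ => (1 : ℝ))) := measurable_const.indicator hC
    exact h1.add ((h3.comp h1).mul h2)

lemma measurable_absorbed {C : Set ℝ} (hC : MeasurableSet C) (n : ℕ) :
    Measurable (absorbed ξ C n) :=
  (h.measurable_absorbed_of hC n).mono (h.le _) le_rfl

lemma indepFun_absorbed {C : Set ℝ} (hC : MeasurableSet C) (n : ℕ) :
    IndepFun (absorbed ξ C n) (ξ n) P := by
  rw [IndepFun_iff_Indep]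
  refine indep_of_indep_of_le_left (indep_of_indep_of_le_right
    (h.indep (Set.Iio n) {n} (by simp)) (h.meas n).comap_le)
    (h.measurable_absorbed_of hC n).comap_le

lemma shift (k : ℕ) : IndepSteps P (fun i => ξ (k + i)) (fun S => m ((fun i => k + i) '' S)) where
  mono := fun S T hST => h.mono (Set.image_mono hST)
  le := fun S => h.le _
  indep := fun S T hST => h.indep _ _ <|
    (Set.disjoint_image_iff (add_right_injective k)).2 hST
  meas := fun n => by rw [Set.image_singleton]; exact h.meas (k + n)
  ident := fun n => (h.ident (k + n)).trans (h.ident (k + 0)).symm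

variable [IsProbabilityMeasure P]

/-- A bounded function that is superharmonic for the walk on `C` decreases in mean along the walk
absorbed outside `C`. -/
lemma integral_absorbed_le {C : Set ℝ} (hC : MeasurableSet C) {U : ℝ → ℝ} (hU : Measurable U)
    (hU0 : ∀ s, 0 ≤ U s) (hU1 : ∀ s, U s ≤ 1)
    (hsup : ∀ s ∈ C, ∫ ω, U (s + ξ 0 ω) ∂P ≤ U s) (n : ℕ) :
    ∫ ω, U (absorbed ξ C n ω) ∂P ≤ U 0 := by
  have hbd : ∀ s, ‖U s‖ ≤ 1 := fun s => by rw [Real.norm_eq_abs, abs_of_nonneg (hU0 s)]; exact hU1 s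
  induction n with
  | zero => simp [absorbed]
  | succ n ih =>
    refine le_trans ?_ ih
    have hX := h.measurable_absorbed hC n
    have hξ := h.measurable n
    set f : ℝ × ℝ → ℝ := fun p => U (p.1 + C.indicator (fun _ => (1 : ℝ)) p.1 * p.2) with hf
    have hCm : Measurable (C.indicator (fun _ => (1 : ℝ))) := measurable_const.indicator hC
    have hfm : Measurable f := by fun_prop
    have h1 : ∫ ω, U (absorbed ξ C (n + 1) ω) ∂P =
        ∫ p, f p ∂((P.map (absorbed ξ C n)).prod (P.map (ξ n))) := by
      rw [← (indepFun_iff_map_prod_eq_prod_map_map hX.aemeasurable hξ.aemeasurable).1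
        (h.indepFun_absorbed hC n), integral_map (by fun_prop) hfm.aestronglyMeasurable]
      rfl
    have hP1 : IsProbabilityMeasure (P.map (absorbed ξ C n)) :=
      Measure.isProbabilityMeasure_map hX.aemeasurable
    have hP2 : IsProbabilityMeasure (P.map (ξ n)) :=
      Measure.isProbabilityMeasure_map hξ.aemeasurable
    have hfi : Integrable f ((P.map (absorbed ξ C n)).prod (P.map (ξ n))) :=
      Integrable.of_bound hfm.aestronglyMeasurable 1 (Eventually.of_forall fun p => hbd _)
    rw [h1, integral_prod _ hfi, ← integral_map hX.aemeasurable hU.aestronglyMeasurable]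
    refine integral_mono hfi.integral_prod_left
      (Integrable.of_bound hU.aestronglyMeasurable 1 (Eventually.of_forall hbd)) fun x => ?_
    by_cases hx : x ∈ C
    · have h2 : ∫ r, f (x, r) ∂(P.map (ξ n)) = ∫ ω, U (x + ξ 0 ω) ∂P := by
        rw [(h.ident n).map_eq, integral_map (h.measurable 0).aemeasurable
          (by fun_prop : Measurable fun r => f (x, r)).aestronglyMeasurable]
        simp [hf, hx]
      simpa only [h2] using hsup x hx
    · simp [hf, hx]

/-- The mean number of steps until a walk with negative drift and steps bounded below by `-A`
becomes negative is at most `A` divided by the absolute drift. -/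
lemma sum_prob_nonneg_le {A : ℝ} (hA : 0 ≤ A) (hint : Integrable (ξ 0) P)
    (hneg : ∫ ω, ξ 0 ω ∂P ≤ 0) (hlow : ∀ n, ∀ᵐ ω ∂P, -A ≤ ξ n ω) (n : ℕ) :
    (∑ k ∈ Finset.range n, P.real {ω | ∀ j ≤ k, 0 ≤ psum ξ j ω}) * -(∫ ω, ξ 0 ω ∂P) ≤ A := by
  have hC : MeasurableSet (Set.Ici (0 : ℝ)) := measurableSet_Ici
  set X := absorbed ξ (Set.Ici (0 : ℝ)) with hX
  have hind : Measurable ((Set.Ici (0 : ℝ)).indicator (fun _ => (1 : ℝ))) :=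
    measurable_const.indicator hC
  have hXm : ∀ n, Measurable (X n) := h.measurable_absorbed hC
  have hξi : ∀ n, Integrable (ξ n) P := fun n => (h.ident n).integrable_iff.2 hint
  have hiInd : ∀ n, IndepFun (fun ω => (Set.Ici (0 : ℝ)).indicator (fun _ => (1 : ℝ)) (X n ω)) (ξ n) P :=
    fun n => (h.indepFun_absorbed hC n).comp hind measurable_id
  have hi1 : ∀ n, Integrable
      (fun ω => (Set.Ici (0 : ℝ)).indicator (fun _ => (1 : ℝ)) (X n ω) * ξ n ω) P := fun n =>
    (hξi n).bdd_mul (c := 1) (hind.comp (hXm n)).aestronglyMeasurable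
      (Eventually.of_forall fun ω => (norm_indicator_le_norm_self _ _).trans (by simp))
  have hXi : ∀ n, Integrable (X n) P := by
    intro n
    induction n with
    | zero => exact integrable_const 0
    | succ n ih => exact ih.add (hi1 n)
  have hXint : ∀ n, ∫ ω, X n ω ∂P =
      (∑ k ∈ Finset.range n, P.real {ω | 0 ≤ X k ω}) * ∫ ω, ξ 0 ω ∂P := by
    intro n
    induction n with
    | zero => simp [hX, absorbed]
    | succ n ih =>
      have h1 : ∫ ω, X (n + 1) ω ∂P = ∫ ω, (X n ω +
          (Set.Ici (0 : ℝ)).indicator (fun _ => (1 : ℝ)) (X n ω) * ξ n ω) ∂P := rfl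
      have h2 : ∫ ω, (Set.Ici (0 : ℝ)).indicator (fun _ => (1 : ℝ)) (X n ω) ∂P =
          P.real {ω | 0 ≤ X n ω} := by
        rw [← integral_indicator_one (measurableSet_le measurable_const (hXm n))]
        rfl
      rw [h1, integral_add (hXi n) (hi1 n), (hiInd n).integral_fun_mul_eq_mul_integral
        (hind.comp (hXm n)).aestronglyMeasurable (h.measurable n).aestronglyMeasurable, ih,
        (h.ident n).integral_eq, h2, Finset.sum_range_succ]
      ring
  have hlowX : ∀ᵐ ω ∂P, -A ≤ X n ω := by
    filter_upwards [ae_all_iff.2 hlow] with ω hω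
    induction n with
    | zero => simpa [hX, absorbed] using hA
    | succ n ih =>
      by_cases hn : X n ω ∈ Set.Ici (0 : ℝ)
      · have h1 := hω n
        have h2 : 0 ≤ X n ω := hn
        have h3 : X (n + 1) ω = X n ω + 1 * ξ n ω := by
          simp only [hX, absorbed]
          rw [Set.indicator_of_mem hn]
        linarith
      · have h3 : X (n + 1) ω = X n ω + 0 * ξ n ω := by
          simp only [hX, absorbed]
          rw [Set.indicator_of_notMem hn]
        linarith
  have hlowI : -A ≤ ∫ ω, X n ω ∂P := by
    simpa using integral_mono_ae (integrable_const (-A)) (hXi n) hlowX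
  have hle : ∑ k ∈ Finset.range n, P.real {ω | ∀ j ≤ k, 0 ≤ psum ξ j ω} ≤
      ∑ k ∈ Finset.range n, P.real {ω | 0 ≤ X k ω} := by
    refine Finset.sum_le_sum fun k _ => measureReal_mono fun ω hω => ?_
    have : X k ω = psum ξ k ω := absorbed_eq_psum fun j hj => hω j hj.le
    change 0 ≤ X k ω
    rw [this]
    exact hω k le_rfl
  have := mul_le_mul_of_nonneg_right hle (neg_nonneg.2 hneg)
  rw [hXint] at hlowI
  linarith

end IndepSteps

section Bounds

variable [IsProbabilityMeasure P] (h : IndepSteps P ξ m) {G : ℝ → ℝ} {K : ℝ} (hK : 0 < K) (hG : Antitone G)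
  (hG0 : ∀ y, 0 ≤ G y)
  (hdrift : ∀ y, K * G y < 1 → ∫ ω, min 1 (K * G (y - ξ 0 ω)) ∂P ≤ K * G y)
include h hK hG hG0 hdrift

/-- The hypothesis `hdrift` on `K G` says that `s ↦ min 1 (K G (x - s))` is superharmonic where it is
smaller than `1`, for every `x`. -/
lemma integral_cap_absorbed_le (x : ℝ) {C : Set ℝ} (hC : MeasurableSet C)
    (hCK : ∀ s ∈ C, K * G (x - s) < 1) (n : ℕ) :
    ∫ ω, min 1 (K * G (x - absorbed ξ C n ω)) ∂P ≤ K * G x := by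
  have hm : Measurable G := hG.measurable
  refine (h.integral_absorbed_le hC (U := fun s => min 1 (K * G (x - s))) (by fun_prop)
    (fun s => le_min zero_le_one (mul_nonneg hK.le (hG0 _))) (fun s => min_le_left _ _)
    (fun s hs => ?_) n).trans (by simp)
  rw [min_eq_right (hCK s hs).le]
  convert hdrift (x - s) (hCK s hs) using 5
  ring_nf

variable (hKG : 1 ≤ K * G 0)
include hKG

/-- Bound for the overall maximum of a walk with negative drift. -/
lemma prob_exists_psum_ge_le (y : ℝ) (N : ℕ) :
    P.real {ω | ∃ n ≤ N, y ≤ psum ξ n ω} ≤ K * G y := by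
  have hm : Measurable G := hG.measurable
  set C : Set ℝ := {s | K * G (y - s) < 1} with hCdef
  have hC : MeasurableSet C := measurableSet_lt (by fun_prop) measurable_const
  refine le_trans ?_ (integral_cap_absorbed_le h hK hG hG0 hdrift y hC (fun s hs => hs) N)
  have hE : MeasurableSet {ω | ∃ n ≤ N, y ≤ psum ξ n ω} := by
    have := h.measurable_psum
    measurability
  have hX := h.measurable_absorbed hC N
  have hU0 : ∀ ω, 0 ≤ min 1 (K * G (y - absorbed ξ C N ω)) := fun ω =>
    le_min zero_le_one (mul_nonneg hK.le (hG0 _))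
  rw [← integral_indicator_one hE]
  refine integral_mono ((integrable_const 1).indicator hE) (Integrable.of_bound
    (by fun_prop : Measurable fun ω => min 1 (K * G (y - absorbed ξ C N ω))).aestronglyMeasurable 1
    (Eventually.of_forall fun ω => by
      rw [Real.norm_eq_abs, abs_of_nonneg (hU0 ω)]; exact min_le_left _ _)) fun ω => ?_
  by_cases hω : ω ∈ {ω | ∃ n ≤ N, y ≤ psum ξ n ω}
  · rw [Set.indicator_of_mem hω]
    obtain ⟨n, hn, hy⟩ := hω
    have hout : psum ξ n ω ∉ C := by
      have h1 : G 0 ≤ G (y - psum ξ n ω) := hG (by linarith)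
      have h2 := mul_le_mul_of_nonneg_left h1 hK.le
      simp only [hCdef, Set.mem_ofPred_eq, not_lt]
      linarith
    obtain ⟨k, _, _, hk, hk2⟩ := exists_absorbed_eq ⟨n, hn, hout⟩
    simp only [hCdef, Set.mem_ofPred_eq, not_lt] at hk
    simp only [hk2, Pi.one_apply]
    exact le_min le_rfl hk
  · rw [Set.indicator_of_notMem hω]
    exact hU0 ω

/-- Bound for the maximum of a walk before it becomes negative. The superharmonic function
`K G (x - ·)` starts at `K G x`; on excursions that do not reach `x` it is still at least
`K G (x + A)`, because steps are bounded below by `-A`. So the gap `K (G x - G (x + A))` bounds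
the probability of reaching `x`, up to the factor `1 - K G (x + A) ≥ 1 / 2`. -/
lemma prob_excursion_gt_le {A : ℝ} (hA : 0 ≤ A) (hlow : ∀ n, ∀ᵐ ω ∂P, -A ≤ ξ n ω) {x : ℝ}
    (hx : K * G x ≤ 1 / 2) (N : ℕ) :
    P.real {ω | ∃ n ≤ N, (∀ k ≤ n, 0 ≤ psum ξ k ω) ∧ x < psum ξ n ω} ≤
      2 * (K * (G x - G (x + A))) := by
  have hm : Measurable G := hG.measurable
  set C : Set ℝ := {s | 0 ≤ s ∧ K * G (x - s) < 1} with hCdef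
  have hC : MeasurableSet C := measurableSet_Ici.inter
    (measurableSet_lt (f := fun s => K * G (x - s)) (by fun_prop) measurable_const)
  have hint := integral_cap_absorbed_le h hK hG hG0 hdrift x hC (fun s hs => hs.2) N
  set E := {ω | ∃ n ≤ N, (∀ k ≤ n, 0 ≤ psum ξ k ω) ∧ x < psum ξ n ω} with hEdef
  have hE : MeasurableSet E := by
    have := h.measurable_psum
    measurability
  have hX := h.measurable_absorbed hC N
  have hU0 : ∀ ω, 0 ≤ min 1 (K * G (x - absorbed ξ C N ω)) := fun ω =>
    le_min zero_le_one (mul_nonneg hK.le (hG0 _))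
  have hGA : G (x + A) ≤ G x := hG (by linarith)
  have hGA' := mul_le_mul_of_nonneg_left hGA hK.le
  have hlowX : ∀ᵐ ω ∂P, -A ≤ absorbed ξ C N ω := by
    filter_upwards [ae_all_iff.2 hlow] with ω hω
    have : ∀ n, -A ≤ absorbed ξ C n ω := by
      intro n
      induction n with
      | zero => simpa [absorbed] using hA
      | succ n ih =>
        by_cases hn : absorbed ξ C n ω ∈ C
        · have h1 := hω n
          have h2 : 0 ≤ absorbed ξ C n ω := hn.1
          simp only [absorbed, Set.indicator_of_mem hn]
          linarith
        · simpa [absorbed, Set.indicator_of_notMem hn] using ih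
    exact this N
  have hpt : ∀ᵐ ω ∂P, K * G (x + A) + (1 - K * G (x + A)) * E.indicator 1 ω ≤
      min 1 (K * G (x - absorbed ξ C N ω)) := by
    filter_upwards [hlowX] with ω hω
    by_cases hωE : ω ∈ E
    · rw [Set.indicator_of_mem hωE]
      obtain ⟨n, hn, hpos, hxn⟩ := hωE
      have hout : psum ξ n ω ∉ C := by
        have h1 : G 0 ≤ G (x - psum ξ n ω) := hG (by linarith)
        have h2 := mul_le_mul_of_nonneg_left h1 hK.le
        intro hmem
        linarith [hmem.2]
      obtain ⟨k, hk0, hmin, hk, hk2⟩ := exists_absorbed_eq ⟨n, hn, hout⟩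
      have hkn := hmin n hn hout
      have : 1 ≤ K * G (x - psum ξ k ω) := by
        by_contra! hlt
        exact hk ⟨hpos k hkn, hlt⟩
      rw [hk2]
      simp only [Pi.one_apply]
      exact le_min (by linarith) (by linarith)
    · rw [Set.indicator_of_notMem hωE]
      have h1 : G (x + A) ≤ G (x - absorbed ξ C N ω) := hG (by linarith)
      have h2 := mul_le_mul_of_nonneg_left h1 hK.le
      exact le_min (by linarith) (by linarith)
  have hi1 : Integrable (fun ω => (1 - K * G (x + A)) * E.indicator (1 : Ω → ℝ) ω) P :=
    ((integrable_const 1).indicator hE).const_mul _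
  have hle := integral_mono_ae ((integrable_const _).add hi1) (Integrable.of_bound
    (by fun_prop : Measurable fun ω => min 1 (K * G (x - absorbed ξ C N ω))).aestronglyMeasurable 1
    (Eventually.of_forall fun ω => by
      rw [Real.norm_eq_abs, abs_of_nonneg (hU0 ω)]; exact min_le_left _ _)) hpt
  simp only [Pi.add_apply] at hle
  rw [integral_add (integrable_const _) hi1, integral_const_mul (1 - K * G (x + A)),
    integral_indicator_one hE] at hle
  simp only [integral_const, probReal_univ, smul_eq_mul, one_mul] at hle
  have hp : 0 ≤ P.real E := measureReal_nonneg
  nlinarith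

/-- An excursion that reaches `3 z` with steps at most `z` passes through `(z, 2 z]` and has to
climb by another `z` from there, so by the Markov property it is much less likely than an excursion
reaching `z`. -/
lemma prob_excursion_no_big_step_le {A : ℝ} (hA : 0 ≤ A) (hlow : ∀ n, ∀ᵐ ω ∂P, -A ≤ ξ n ω) {z : ℝ}
    (hz : K * G z ≤ 1 / 2) (hz0 : 0 ≤ z) (N : ℕ) :
    P.real {ω | ∃ n ≤ N, (∀ k ≤ n, 0 ≤ psum ξ k ω) ∧ (∀ k < n, ξ k ω ≤ z) ∧ 3 * z < psum ξ n ω} ≤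
      2 * (K * (G z - G (z + A))) * (K * G z) := by
  classical
  set E : ℕ → Set Ω := fun k => {ω | (∀ j ≤ k, 0 ≤ psum ξ j ω) ∧ (∀ j < k, psum ξ j ω ≤ z) ∧
    z < psum ξ k ω} with hE
  set F : ℕ → Set Ω := fun k => {ω | ∃ j ≤ N, z ≤ psum (fun i => ξ (k + i)) j ω} with hF
  have hEm : ∀ k, MeasurableSet[m (Set.Iio k)] (E k) := by
    intro k
    have h1 : ∀ j ≤ k, Measurable[m (Set.Iio k)] (psum ξ j) := fun j hj =>
      h.measurable_psum_of j (Set.Iio_subset_Iio hj)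
    have e : E k = (⋂ j, ⋂ (_ : j ≤ k), {ω | 0 ≤ psum ξ j ω}) ∩
        ((⋂ j, ⋂ (_ : j < k), {ω | psum ξ j ω ≤ z}) ∩ {ω | z < psum ξ k ω}) := by
      ext ω; simp [hE]
    rw [e]
    refine MeasurableSet.inter (MeasurableSet.iInter fun j => MeasurableSet.iInter fun hj => ?_)
      (MeasurableSet.inter (MeasurableSet.iInter fun j => MeasurableSet.iInter fun hj => ?_) ?_)
    · exact h1 j hj measurableSet_Ici
    · exact h1 j hj.le measurableSet_Iic
    · exact h1 k le_rfl measurableSet_Ioi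
  have hFm : ∀ k, MeasurableSet[m (Set.Ici k)] (F k) := by
    intro k
    have h1 : ∀ j, Measurable[m (Set.Ici k)] (psum (fun i => ξ (k + i)) j) := fun j =>
      ((h.shift k).measurable_psum_of j subset_rfl).mono (h.mono (by
        rintro _ ⟨i, _, rfl⟩; simp)) le_rfl
    have e : F k = ⋃ j, ⋃ (_ : j ≤ N), {ω | z ≤ psum (fun i => ξ (k + i)) j ω} := by
      ext ω; simp [hF]
    rw [e]
    exact MeasurableSet.iUnion fun j => MeasurableSet.iUnion fun _ => h1 j measurableSet_Ici
  have hprod : ∀ k, P.real (E k ∩ F k) = P.real (E k) * P.real (F k) := fun k => by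
    rw [Measure.real, (Indep_iff _ _ P).1 (h.indep (Set.Iio k) (Set.Ici k)
      (Set.disjoint_left.2 fun i hi hi' => absurd (Set.mem_Iio.1 hi) (not_lt.2 hi'))) _ _ (hEm k) (hFm k),
      ENNReal.toReal_mul]
    rfl
  have hFle : ∀ k, P.real (F k) ≤ K * G z := fun k => by
    refine prob_exists_psum_ge_le (h.shift k) hK hG hG0 (fun y hy => ?_) hKG z N
    have hm : Measurable G := hG.measurable
    have := (((h.ident k).comp (u := fun r => min 1 (K * G (y - r))) (by fun_prop))).integral_eq
    simp only [Function.comp_def] at this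
    simpa only [add_zero, this] using hdrift y hy
  have hsub : {ω | ∃ n ≤ N, (∀ k ≤ n, 0 ≤ psum ξ k ω) ∧ (∀ k < n, ξ k ω ≤ z) ∧
      3 * z < psum ξ n ω} ⊆ ⋃ k ∈ Finset.range (N + 1), E k ∩ F k := by
    rintro ω ⟨n, hn, hpos, hstep, hbig⟩
    have hex : ∃ k, z < psum ξ k ω := ⟨n, by linarith⟩
    have hkn : Nat.find hex ≤ n := Nat.find_min' hex (by linarith)
    have hmin : ∀ j < Nat.find hex, psum ξ j ω ≤ z := fun j hj => not_lt.1 (Nat.find_min hex hj)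
    have hspec := Nat.find_spec hex
    set k := Nat.find hex with hk
    simp only [Set.mem_iUnion, Finset.mem_range]
    refine ⟨k, by omega, ⟨fun j hj => hpos j (hj.trans hkn), hmin, hspec⟩, n - k, by omega, ?_⟩
    have hk0 : k ≠ 0 := by
      intro h0
      rw [h0, psum_zero] at hspec
      linarith
    obtain ⟨l, hl⟩ := Nat.exists_eq_succ_of_ne_zero hk0
    have h1 := hmin l (by omega)
    have h2 := hstep l (by omega)
    have h3 : psum ξ k ω = psum ξ l ω + ξ l ω := by rw [hl]; exact psum_succ _ _ _
    have h4 := psum_add ξ k (n - k) ω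
    rw [Nat.add_sub_cancel' hkn] at h4
    linarith
  have hEm' : ∀ k, MeasurableSet (E k) := fun k => h.le _ _ (hEm k)
  have hdisj : Pairwise (Function.onFun Disjoint E) := by
    have key : ∀ i j, i < j → Disjoint (E i) (E j) := fun i j hij =>
      Set.disjoint_left.2 fun ω hi hj => absurd hi.2.2 (not_lt.2 (hj.2.1 i hij))
    intro i j hij
    rcases lt_or_gt_of_ne hij with h1 | h1
    · exact key i j h1
    · exact (key j i h1).symm
  have hU : ∑ k ∈ Finset.range (N + 1), P.real (E k) ≤ 2 * (K * (G z - G (z + A))) := by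
    rw [← measureReal_biUnion_finset (fun i _ j _ hij => hdisj hij) fun k _ => hEm' k]
    refine (measureReal_mono ?_).trans
      (prob_excursion_gt_le h hK hG hG0 hdrift hKG hA hlow hz N)
    intro ω hω
    simp only [Set.mem_iUnion, Finset.mem_range] at hω
    obtain ⟨k, hk, hωk⟩ := hω
    exact ⟨k, by omega, hωk.1, hωk.2.2⟩
  calc _ ≤ P.real (⋃ k ∈ Finset.range (N + 1), E k ∩ F k) :=
        measureReal_mono hsub (measure_ne_top _ _)
    _ ≤ ∑ k ∈ Finset.range (N + 1), P.real (E k ∩ F k) := measureReal_biUnion_finset_le _ _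
    _ ≤ ∑ k ∈ Finset.range (N + 1), P.real (E k) * (K * G z) := by
        refine Finset.sum_le_sum fun k _ => ?_
        rw [hprod]
        exact mul_le_mul_of_nonneg_left (hFle k) measureReal_nonneg
    _ = (∑ k ∈ Finset.range (N + 1), P.real (E k)) * (K * G z) := by rw [Finset.sum_mul]
    _ ≤ _ := mul_le_mul_of_nonneg_right hU (mul_nonneg hK.le (hG0 _))

end Bounds

end Walk

/-! ### The busy period as an excursion of the walk -/

section Pathwise

variable {Ω : Type*} {t σ : ℕ → Ω → ℝ} {ω : Ω}

lemma walk_eq_sub (n : ℕ) : walk t σ n ω = psum σ n ω - arrival t n ω := by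
  simp [walk, psum, arrival]

lemma add_one_le_numServed_iff (n : ℕ) :
    ((n + 1 : ℕ) : ℕ∞) ≤ numServed t σ ω ↔ ∀ k, 1 ≤ k → k ≤ n → 0 < walk t σ k ω := by
  simp only [numServed, le_iInf_iff, Nat.cast_le, and_imp]
  constructor
  · intro h k hk hkn
    by_contra! hneg
    have := h k hk hneg
    omega
  · intro h k hk hneg
    by_contra! hkn
    exact absurd (h k hk (by omega)) (not_lt.2 hneg)

lemma exists_first_return (h : numServed t σ ω ≠ ⊤) :
    ∃ N, walk t σ (N + 1) ω ≤ 0 ∧ ((N + 1 : ℕ) : ℕ∞) ≤ numServed t σ ω := by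
  classical
  have hex : ∃ n, walk t σ (n + 1) ω ≤ 0 := by
    by_contra! hno
    refine h ?_
    simp only [numServed, iInf_eq_top]
    rintro (_ | n) ⟨h1, h2⟩
    · omega
    · exact absurd (hno n) (not_lt.2 h2)
  refine ⟨Nat.find hex, Nat.find_spec hex, (add_one_le_numServed_iff _).2 fun k hk hkn => ?_⟩
  obtain ⟨l, rfl⟩ := Nat.exists_eq_succ_of_ne_zero (show k ≠ 0 by omega)
  exact not_le.1 (Nat.find_min hex (show l < Nat.find hex by omega))

lemma departure_eq_psum {n : ℕ} (h : ((n + 1 : ℕ) : ℕ∞) ≤ numServed t σ ω) :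
    departure t σ n ω = psum σ (n + 1) ω := by
  rw [add_one_le_numServed_iff] at h
  induction n with
  | zero => simp [departure, psum]
  | succ n ih =>
    have h1 := h (n + 1) (by omega) le_rfl
    rw [walk_eq_sub] at h1
    rw [departure, ih fun k hk hkn => h k hk (by omega), max_eq_left (by linarith), ← psum_succ]

lemma departure_mono (hσ : ∀ n, 0 ≤ σ n ω) : Monotone fun n => departure t σ n ω :=
  monotone_nat_of_le_succ fun n => by
    change departure t σ n ω ≤ max (departure t σ n ω) (arrival t (n + 1) ω) + σ (n + 1) ω
    linarith [le_max_left (departure t σ n ω) (arrival t (n + 1) ω), hσ (n + 1)]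

/-- The busy period is the total service time of the customers served in it. -/
lemma busyPeriod_eq (hσ : ∀ n, 0 ≤ σ n ω) {N : ℕ} (hN : walk t σ (N + 1) ω ≤ 0)
    (h : ((N + 1 : ℕ) : ℕ∞) ≤ numServed t σ ω) :
    busyPeriod t σ ω = ((psum σ (N + 1) ω : ℝ) : EReal) := by
  rw [walk_eq_sub] at hN
  apply le_antisymm
  · rw [← departure_eq_psum h]
    refine iInf₂_le N ?_
    rw [departure_eq_psum h]
    linarith
  · refine le_iInf₂ fun n hn => ?_
    rw [← departure_eq_psum h, EReal.coe_le_coe_iff]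
    refine departure_mono hσ ?_
    by_contra! hlt
    have h1 := (add_one_le_numServed_iff N).1 h
    have h2 : ((n + 1 : ℕ) : ℕ∞) ≤ numServed t σ ω :=
      (add_one_le_numServed_iff n).2 fun k hk hkn => h1 k hk (by omega)
    rw [departure_eq_psum h2] at hn
    have h3 := h1 (n + 1) (by omega) hlt
    rw [walk_eq_sub] at h3
    linarith

lemma psum_mono (hσ : ∀ n, 0 ≤ σ n ω) : Monotone fun n => psum σ n ω :=
  monotone_nat_of_le_succ fun n => by
    change psum σ n ω ≤ psum σ (n + 1) ω
    rw [psum_succ]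
    linarith [hσ n]

lemma lt_busyPeriod_of_lt (hσ : ∀ n, 0 ≤ σ n ω) (h : numServed t σ ω ≠ ⊤) {x : ℝ} {n : ℕ}
    (hn : ((n + 1 : ℕ) : ℕ∞) ≤ numServed t σ ω) (hx : x < σ n ω) :
    (x : EReal) < busyPeriod t σ ω := by
  obtain ⟨N, hN, hN'⟩ := exists_first_return h
  rw [busyPeriod_eq hσ hN hN', EReal.coe_lt_coe_iff]
  have hnN : n ≤ N := by
    by_contra! hlt
    exact absurd ((add_one_le_numServed_iff n).1 hn (N + 1) (by omega) hlt) (not_lt.2 hN)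
  have h1 := psum_mono hσ (Nat.add_le_add_right hnN 1)
  have h0 : psum σ 0 ω ≤ psum σ n ω := psum_mono hσ (Nat.zero_le n)
  simp only [psum_succ σ n, psum_zero] at h1 h0
  linarith

/-- Inflating the service times by a factor `l` and truncating the interarrival times raises the
walk by at least `l - 1` times the work brought in so far. -/
lemma walk_add_le_psum (l A : ℝ) (n : ℕ) (ω : Ω) :
    walk t σ n ω + (l - 1) * psum σ n ω ≤ psum (fun n ω => l * σ n ω - min (t n ω) A) n ω := by
  simp only [walk, psum, Finset.mul_sum, ← Finset.sum_add_distrib]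
  refine Finset.sum_le_sum fun i _ => ?_
  have := min_le_left (t i ω) A
  linarith

lemma toENNReal_eq_tsum (k : ℕ∞) :
    (k : ℝ≥0∞) = ∑' n : ℕ, {k : ℕ∞ | ((n + 1 : ℕ) : ℕ∞) ≤ k}.indicator 1 k := by
  induction k using ENat.recTopCoe with
  | top => simp
  | coe k =>
    rw [tsum_eq_sum (s := Finset.range k)]
    · rw [Finset.sum_congr rfl (g := fun _ => 1)]
      · simp
      · intro n hn
        rw [Set.indicator_of_mem]
        · rfl
        · exact (Nat.cast_le (α := ℕ∞)).2 (Finset.mem_range.1 hn)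
    · intro n hn
      rw [Set.indicator_of_notMem]
      simpa only [Set.mem_ofPred_eq, Nat.cast_le, Finset.mem_range, Nat.add_one_le_iff] using hn

lemma numServed_eq_tsum (ω : Ω) : (numServed t σ ω : ℝ≥0∞) =
    ∑' n : ℕ, {ω | ((n + 1 : ℕ) : ℕ∞) ≤ numServed t σ ω}.indicator 1 ω :=
  toENNReal_eq_tsum _

end Pathwise

section Queue

variable {Ω : Type*} 

/-- The σ-algebra generated by the service times `σ i`, `Sum.inl i ∈ J`, and the interarrival times
`t i`, `Sum.inr i ∈ J`. -/
abbrev info (t σ : ℕ → Ω → ℝ) (J : Set (ℕ ⊕ ℕ)) : MeasurableSpace Ω :=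
  ⨆ j ∈ J, MeasurableSpace.comap (Sum.elim σ t j) inferInstance

lemma info_mono (t σ : ℕ → Ω → ℝ) : Monotone (info t σ) := fun _ _ h => biSup_mono h

lemma measurable_info_σ {t σ : ℕ → Ω → ℝ} {J : Set (ℕ ⊕ ℕ)} {n : ℕ} (h : Sum.inl n ∈ J) :
    Measurable[info t σ J] (σ n) :=
  Measurable.of_comap_le (le_biSup (fun j => MeasurableSpace.comap (Sum.elim σ t j) inferInstance) h)

lemma measurable_info_t {t σ : ℕ → Ω → ℝ} {J : Set (ℕ ⊕ ℕ)} {n : ℕ} (h : Sum.inr n ∈ J) :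
    Measurable[info t σ J] (t n) :=
  Measurable.of_comap_le (le_biSup (fun j => MeasurableSpace.comap (Sum.elim σ t j) inferInstance) h)

/-- Whether customer `n` is served in the first busy period depends on earlier customers only. -/
lemma measurableSet_info_served (t σ : ℕ → Ω → ℝ) (n : ℕ) :
    MeasurableSet[info t σ {j | Sum.elim id id j < n}]
      {ω | ((n + 1 : ℕ) : ℕ∞) ≤ numServed t σ ω} := by
  have e : {ω | ((n + 1 : ℕ) : ℕ∞) ≤ numServed t σ ω} =
      ⋂ k, ⋂ (_ : 1 ≤ k), ⋂ (_ : k ≤ n), {ω | 0 < walk t σ k ω} := by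
    ext ω
    simp only [Set.mem_ofPred_eq, add_one_le_numServed_iff, Set.mem_iInter]
  rw [e]
  refine MeasurableSet.iInter fun k => MeasurableSet.iInter fun _ => MeasurableSet.iInter fun hk => ?_
  have : Measurable[info t σ {j | Sum.elim id id j < n}] (walk t σ k) :=
    Finset.measurable_fun_sum _ fun i hi => (measurable_info_σ (by
      simpa using (Finset.mem_range.1 hi).trans_le hk)).sub (measurable_info_t (by
      simpa using (Finset.mem_range.1 hi).trans_le hk))
  exact this measurableSet_Ioi

namespace IsStableQueue

variable [mΩ : MeasurableSpace Ω] {P : Measure Ω} {t σ : ℕ → Ω → ℝ} (hQ : IsStableQueue P t σ)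
include hQ

lemma info_le (J : Set (ℕ ⊕ ℕ)) : info t σ J ≤ mΩ := by
  refine iSup₂_le fun j _ => ?_
  rcases j with n | n
  · exact (hQ.measurable_σ n).comap_le
  · exact (hQ.measurable_t n).comap_le

lemma indep_info {J J' : Set (ℕ ⊕ ℕ)} (h : Disjoint J J') : Indep (info t σ J) (info t σ J') P := by
  refine indep_iSup_of_disjoint (fun j => ?_) hQ.indep.iIndep h
  rcases j with n | n
  · exact (hQ.measurable_σ n).comap_le
  · exact (hQ.measurable_t n).comap_le

/-- Independence of the information in disjoint sets of inputs, for probabilities of events. -/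
lemma measureReal_inter {J J' : Set (ℕ ⊕ ℕ)} (h : Disjoint J J') {E F : Set Ω}
    (hE : MeasurableSet[info t σ J] E) (hF : MeasurableSet[info t σ J'] F) :
    P.real (E ∩ F) = P.real E * P.real F := by
  rw [Measure.real, (Indep_iff _ _ P).1 (hQ.indep_info h) E F hE hF, ENNReal.toReal_mul]
  rfl

lemma tail_eq (n : ℕ) (x : ℝ) : P.real {ω | x < σ n ω} = tail (P.map (σ 0)) x := by
  rw [tail, ← (hQ.identDistrib_σ n).map_eq, map_measureReal_apply (hQ.measurable_σ n) measurableSet_Ioi]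
  rfl

lemma indepSteps [IsProbabilityMeasure P] {f : ℝ × ℝ → ℝ} (hf : Measurable f) :
    IndepSteps P (fun n ω => f (σ n ω, t n ω))
      (fun S => info t σ {j | Sum.elim id id j ∈ S}) where
  mono := fun S T h => info_mono t σ fun j hj => h hj
  le := fun S => hQ.info_le _
  indep := fun S T h => hQ.indep_info <| Set.disjoint_left.2 fun j hj hj' =>
    Set.disjoint_left.1 h hj hj'
  meas := fun n => hf.comp <| (measurable_info_σ (by simp)).prodMk (measurable_info_t (by simp))
  ident := fun n => by
    have hi : ∀ n, IndepFun (σ n) (t n) P := fun n =>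
      hQ.indep.indepFun (i := Sum.inl n) (j := Sum.inr n) (by simp)
    exact ((hQ.identDistrib_σ n).prodMk (hQ.identDistrib_t n) (hi n) (hi 0)).comp hf

lemma mean_lt : ∫ ω, σ 0 ω ∂P < ∫ ω, t 0 ω ∂P := (div_lt_one hQ.mean_t_pos).1 hQ.stable

lemma rho_pos : 0 < rho P t σ := div_pos hQ.mean_σ_pos hQ.mean_t_pos

lemma rho_lt_one : rho P t σ < 1 := hQ.stable

/-- The negative drift survives a slight inflation of the service times and a truncation of the
interarrival times. -/
lemma exists_inflation_truncation :
    ∃ l A : ℝ, 1 < l ∧ 0 ≤ A ∧ ∫ ω, l * σ 0 ω ∂P < ∫ ω, min (t 0 ω) A ∂P := by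
  set b := ∫ ω, σ 0 ω ∂P with hb
  set a := ∫ ω, t 0 ω ∂P with ha
  have hab : b < a := hQ.mean_lt
  have hb0 : 0 < b := hQ.mean_σ_pos
  have hlim : Tendsto (fun A : ℝ => ∫ ω, min (t 0 ω) A ∂P) atTop (𝓝 a) := by
    refine tendsto_integral_filter_of_dominated_convergence (fun ω => |t 0 ω|) ?_ ?_
      hQ.integrable_t.abs ?_
    · exact Eventually.of_forall fun A =>
        ((hQ.measurable_t 0).min measurable_const).aestronglyMeasurable
    · filter_upwards [eventually_ge_atTop 0] with A hA
      filter_upwards [hQ.t_nonneg 0] with ω hω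
      rw [Real.norm_eq_abs, abs_of_nonneg (le_min hω hA), abs_of_nonneg hω]
      exact min_le_left _ _
    · refine Eventually.of_forall fun ω => tendsto_const_nhds.congr' ?_
      filter_upwards [eventually_ge_atTop (t 0 ω)] with A hA
      rw [min_eq_left hA]
  obtain ⟨A, hA, hA0⟩ := ((hlim.eventually (lt_mem_nhds (show (a + b) / 2 < a by linarith))).and
    (eventually_ge_atTop 0)).exists
  refine ⟨(a + b) / 2 / b, A, by rw [lt_div_iff₀ hb0]; linarith, hA0, ?_⟩
  rw [integral_const_mul, ← hb, div_mul_cancel₀ _ hb0.ne']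
  exact hA

lemma ae_nonneg : ∀ᵐ ω ∂P, (∀ n, 0 ≤ σ n ω) ∧ ∀ n, 0 ≤ t n ω := by
  filter_upwards [ae_all_iff.2 hQ.σ_nonneg, ae_all_iff.2 hQ.t_nonneg] with ω h1 h2
  exact ⟨h1, h2⟩

lemma measurableSet_served (n : ℕ) :
    MeasurableSet {ω | ((n + 1 : ℕ) : ℕ∞) ≤ numServed t σ ω} :=
  hQ.info_le _ _ (measurableSet_info_served t σ n)

lemma prob_served_inter (n : ℕ) {E : Set ℝ} (hE : MeasurableSet E) :
    P.real {ω | ((n + 1 : ℕ) : ℕ∞) ≤ numServed t σ ω ∧ σ n ω ∈ E} =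
      P.real {ω | ((n + 1 : ℕ) : ℕ∞) ≤ numServed t σ ω} * P.real {ω | σ n ω ∈ E} :=
  hQ.measureReal_inter (J' := {Sum.inl n}) (by simp) (measurableSet_info_served t σ n)
    (measurable_info_σ (t := t) (Set.mem_singleton _) hE)

lemma summable_served [IsProbabilityMeasure P] :
    Summable fun n : ℕ => P.real {ω | ((n + 1 : ℕ) : ℕ∞) ≤ numServed t σ ω} := by
  obtain ⟨l, A, hl, hA, hlt⟩ := hQ.exists_inflation_truncation
  have hsteps := hQ.indepSteps (f := fun p => l * p.1 - min p.2 A) (by fun_prop)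
  have hi1 : Integrable (fun ω => l * σ 0 ω) P := hQ.integrable_σ.const_mul l
  have hi2 : Integrable (fun ω => min (t 0 ω) A) P := hQ.integrable_t.inf (integrable_const A)
  have hint : ∫ ω, (l * σ 0 ω - min (t 0 ω) A) ∂P =
    ∫ ω, l * σ 0 ω ∂P - ∫ ω, min (t 0 ω) A ∂P := integral_sub hi1 hi2
  have hneg : ∫ ω, (l * σ 0 ω - min (t 0 ω) A) ∂P < 0 := by rw [hint]; linarith
  have hlow : ∀ n, ∀ᵐ ω ∂P, -A ≤ l * σ n ω - min (t n ω) A := fun n => by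
    filter_upwards [hQ.σ_nonneg n] with ω hω
    have : 0 ≤ l * σ n ω := by positivity
    linarith [min_le_right (t n ω) A]
  refine summable_of_sum_range_le (c := A / -(∫ ω, (l * σ 0 ω - min (t 0 ω) A) ∂P))
    (fun n => measureReal_nonneg) fun n => ?_
  rw [le_div_iff₀ (by linarith)]
  refine le_trans (mul_le_mul_of_nonneg_right (Finset.sum_le_sum fun k _ => ?_) (by linarith))
    (hsteps.sum_prob_nonneg_le hA (hi1.sub hi2) hneg.le hlow n)
  refine ENNReal.toReal_mono (measure_ne_top _ _) (measure_mono_ae ?_)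
  filter_upwards [hQ.ae_nonneg] with ω hω hserved j hj
  have h1 := (add_one_le_numServed_iff k).1 hserved
  rcases Nat.eq_zero_or_pos j with rfl | hj0
  · simp
  · have h2 := h1 j hj0 hj
    have h3 := walk_add_le_psum (t := t) (σ := σ) l A j ω
    have h4 : psum σ 0 ω ≤ psum σ j ω := psum_mono hω.1 (Nat.zero_le j)
    rw [psum_zero] at h4
    nlinarith

lemma lintegral_numServed :
    ∫⁻ ω, (numServed t σ ω : ℝ≥0∞) ∂P =
      ∑' n : ℕ, P {ω | ((n + 1 : ℕ) : ℕ∞) ≤ numServed t σ ω} := by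
  simp_rw [numServed_eq_tsum]
  rw [lintegral_tsum fun n => (measurable_one.indicator (hQ.measurableSet_served n)).aemeasurable]
  exact tsum_congr fun n => lintegral_indicator_one (hQ.measurableSet_served n)

lemma measurable_numServed : Measurable fun ω => (numServed t σ ω : ℝ≥0∞) := by
  simp_rw [numServed_eq_tsum]
  exact Measurable.tsum fun n => measurable_one.indicator (hQ.measurableSet_served n)

lemma lintegral_numServed_eq_ofReal [IsProbabilityMeasure P] :
    ∫⁻ ω, (numServed t σ ω : ℝ≥0∞) ∂P =
      ENNReal.ofReal (∑' n : ℕ, P.real {ω | ((n + 1 : ℕ) : ℕ∞) ≤ numServed t σ ω}) := by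
  rw [hQ.lintegral_numServed, ENNReal.ofReal_tsum_of_nonneg (fun _ => measureReal_nonneg)
    hQ.summable_served]
  simp [Measure.real, ENNReal.ofReal_toReal]

lemma ae_numServed_ne_top [IsProbabilityMeasure P] : ∀ᵐ ω ∂P, numServed t σ ω ≠ ⊤ := by
  have h := ae_lt_top hQ.measurable_numServed (by rw [hQ.lintegral_numServed_eq_ofReal]; exact ENNReal.ofReal_ne_top)
  filter_upwards [h] with ω hω htop
  rw [htop] at hω
  simp at hω

end IsStableQueue

end Queue

/-! ### Busy periods without a large service time, and the law of large numbers -/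

lemma IsIRV.isBigO {μ : Measure ℝ} [IsProbabilityMeasure μ] (h : IsIRV μ) {r s : ℝ} (hr : 0 < r)
    (hs : 0 < s) : (fun x => tail μ (r * x)) =O[atTop] (fun x => tail μ (s * x)) := by
  obtain ⟨C, hC, hev⟩ := h.dominated (r := r / s) (by positivity)
  have hlim : Tendsto (fun x : ℝ => s * x) atTop atTop := tendsto_id.const_mul_atTop hs
  refine IsBigO.of_bound C ?_
  filter_upwards [hlim.eventually hev] with x hx
  rw [Real.norm_eq_abs, Real.norm_eq_abs, abs_of_nonneg (tail_nonneg _ _),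
    abs_of_nonneg (tail_nonneg _ _)]
  rwa [show r / s * (s * x) = r * x by field_simp] at hx

lemma tendsto_tail (μ : Measure ℝ) [IsFiniteMeasure μ] : Tendsto (tail μ) atTop (𝓝 0) := by
  have h := tendsto_measure_iInter_atTop (μ := μ) (s := fun x : ℝ => Set.Ioi x)
    (fun _ => measurableSet_Ioi.nullMeasurableSet) (fun _ _ h => Set.Ioi_subset_Ioi h)
    ⟨0, measure_ne_top _ _⟩
  have he : ⋂ x : ℝ, Set.Ioi x = ∅ := by
    ext y
    simp only [Set.mem_iInter, Set.mem_Ioi, Set.mem_empty_iff_false, iff_false, not_forall, not_lt]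
    exact ⟨y, le_rfl⟩
  rw [he, measure_empty] at h
  exact (ENNReal.tendsto_toReal ENNReal.zero_ne_top).comp h

namespace IsStableQueue

variable {Ω : Type*} [mΩ : MeasurableSpace Ω] {P : Measure Ω} [IsProbabilityMeasure P]
  {t σ : ℕ → Ω → ℝ} (hQ : IsStableQueue P t σ)
include hQ

lemma isProbabilityMeasure_map : IsProbabilityMeasure (P.map (σ 0)) :=
  Measure.isProbabilityMeasure_map (hQ.measurable_σ 0).aemeasurable

/-- A busy period longer than `x` without a service time of order `x` is negligible. The walk
with inflated service times makes an excursion of order `x` during such a busy period, with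
comparatively small steps. -/
lemma prob_no_big_jump (hIRV : IsIRV (P.map (σ 0))) :
    ∃ η : ℝ, 0 < η ∧ (fun x : ℝ => P.real {ω | (x : EReal) < busyPeriod t σ ω ∧
      ∀ n : ℕ, ((n + 1 : ℕ) : ℕ∞) ≤ numServed t σ ω → σ n ω ≤ η * x})
        =o[atTop] fun x => tail (P.map (σ 0)) x := by
  have := hQ.isProbabilityMeasure_map
  obtain ⟨l, A, hl, hA, hlt⟩ := hQ.exists_inflation_truncation
  have hl0 : 0 < l := by linarith
  have hsteps := hQ.indepSteps (f := fun p => l * p.1 - min p.2 A) (by fun_prop)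
  set ξ : ℕ → Ω → ℝ := fun n ω => l * σ n ω - min (t n ω) A with hξ
  have hi1 : Integrable (fun ω => l * σ 0 ω) P := hQ.integrable_σ.const_mul l
  have hm1 : Measurable (fun ω => l * σ 0 ω) := (hQ.measurable_σ 0).const_mul l
  have hm2 : Measurable (fun ω => min (t 0 ω) A) := (hQ.measurable_t 0).min measurable_const
  have hlow : ∀ n, ∀ᵐ ω ∂P, -A ≤ ξ n ω := fun n => by
    filter_upwards [hQ.σ_nonneg n] with ω hω
    have : 0 ≤ l * σ n ω := by positivity
    simp only [hξ]
    linarith [min_le_right (t n ω) A]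
  have htail : ∀ y, P.real {ω | y < l * σ 0 ω} = tail (P.map (σ 0)) (1 / l * y) := fun y => by
    rw [← hQ.tail_eq 0]
    congr 1
    ext ω
    simp only [Set.mem_ofPred_eq]
    rw [one_div_mul_eq_div, div_lt_iff₀' hl0]
  have hscale : Tendsto (fun y : ℝ => 1 / l * y) atTop atTop :=
    tendsto_id.const_mul_atTop (by positivity)
  obtain ⟨K, hK, hKG, hdrift⟩ := exists_excess_drift (P := P) (Y := fun ω => l * σ 0 ω)
    (T := fun ω => min (t 0 ω) A) (A := A) hm1 hi1 hm2
    (by filter_upwards [hQ.σ_nonneg 0] with ω hω; positivity)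
    (by filter_upwards [hQ.t_nonneg 0] with ω hω; exact ⟨le_min hω hA, min_le_right _ _⟩) hlt
    (fun y => by rw [htail]; exact hIRV.1 _)
    (fun L ε hε => by
      filter_upwards [hscale.eventually (hIRV.shift (1 / l * L) hε)] with y hy
      rw [htail, htail, mul_sub]
      exact hy)
    (by
      obtain ⟨C, hC, hev⟩ := hIRV.dominated (r := 1 / 2) (by norm_num)
      refine ⟨C, hC, ?_⟩
      filter_upwards [hscale.eventually hev] with y hy
      rw [htail, htail, show 1 / l * (1 / 2 * y) = 1 / 2 * (1 / l * y) by ring]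
      exact hy)
  set G := excess P (fun ω => l * σ 0 ω) with hG
  have hGanti : Antitone G := excess_antitone hi1
  have hG0 : ∀ y, 0 ≤ G y := excess_nonneg
  obtain ⟨η, hη0, hη⟩ : ∃ η : ℝ, 0 < η ∧ η = min (1 / 2) ((l - 1) / 6 / l) :=
    ⟨_, lt_min (by norm_num) (by have : 0 < l - 1 := by linarith
                                 positivity), rfl⟩
  have hη2 : η ≤ 1 / 2 := hη ▸ min_le_left _ _
  have hηl : l * η ≤ (l - 1) / 6 := by
    have : η ≤ (l - 1) / 6 / l := hη ▸ min_le_right _ _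
    rw [le_div_iff₀ hl0] at this
    linarith
  refine ⟨η, hη0, ?_⟩
  have hl1 : 0 < (l - 1) / 6 := by linarith
  have hzlim : Tendsto (fun x : ℝ => (l - 1) / 6 * x) atTop atTop := tendsto_id.const_mul_atTop hl1
  have hGlim : Tendsto (fun x : ℝ => G ((l - 1) / 6 * x)) atTop (𝓝 0) :=
    (tendsto_excess hi1).comp hzlim
  -- the excursion bound, uniformly in the time horizon
  have hbound : ∀ᶠ x : ℝ in atTop, P.real {ω | (x : EReal) < busyPeriod t σ ω ∧
      ∀ n : ℕ, ((n + 1 : ℕ) : ℕ∞) ≤ numServed t σ ω → σ n ω ≤ η * x} ≤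
        tail (P.map (σ 0)) (1 / l * ((l - 1) / 6) * x) *
          (2 * K * A * K * G ((l - 1) / 6 * x)) := by
    have hsmall : ∀ᶠ x in atTop, K * G ((l - 1) / 6 * x) ≤ 1 / 2 := by
      have := hGlim.const_mul K
      rw [mul_zero] at this
      exact this.eventually (ge_mem_nhds (by norm_num))
    filter_upwards [hsmall, eventually_gt_atTop 0] with x hx hx0
    set z := (l - 1) / 6 * x with hz
    have hz0 : 0 ≤ z := by positivity
    set D : ℕ → Set Ω := fun N => {ω | ∃ n ≤ N, (∀ k ≤ n, 0 ≤ psum ξ k ω) ∧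
      (∀ k < n, ξ k ω ≤ z) ∧ 3 * z < psum ξ n ω} with hD
    have hDN : ∀ N, P.real (D N) ≤ tail (P.map (σ 0)) (1 / l * ((l - 1) / 6) * x) *
        (2 * K * A * K * G z) := fun N => by
      refine (prob_excursion_no_big_step_le hsteps hK hGanti hG0 hdrift hKG hA hlow hx hz0 N).trans ?_
      have h1 : G z ≤ G (z + A) + A * P.real {ω | z < l * σ 0 ω} := excess_le_add hm1 hi1 z A
      rw [htail, hz, ← mul_assoc, ← hz] at h1
      have h2 : 0 ≤ K * G z := mul_nonneg hK.le (hG0 _)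
      calc 2 * (K * (G z - G (z + A))) * (K * G z)
          ≤ 2 * (K * (A * tail (P.map (σ 0)) (1 / l * ((l - 1) / 6) * x))) * (K * G z) := by
            gcongr; linarith
        _ = _ := by ring
    have hDmono : Monotone D := fun N M hNM ω ⟨n, hn, h⟩ => ⟨n, hn.trans hNM, h⟩
    have hlim : Tendsto (fun N => P.real (D N)) atTop (𝓝 (P.real (⋃ N, D N))) :=
      (ENNReal.tendsto_toReal (measure_ne_top _ _)).comp (tendsto_measure_iUnion_atTop hDmono)
    refine le_trans ?_ (le_of_tendsto' hlim hDN)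
    refine ENNReal.toReal_mono (measure_ne_top _ _) (measure_mono_ae ?_)
    filter_upwards [hQ.ae_nonneg, hQ.ae_numServed_ne_top] with ω ⟨hσ, ht⟩ hτ ⟨hxB, hjump⟩
    obtain ⟨N, hN, hNτ⟩ := exists_first_return hτ
    rw [busyPeriod_eq hσ hN hNτ, EReal.coe_lt_coe_iff, psum_succ] at hxB
    have hserved := (add_one_le_numServed_iff N).1 hNτ
    have hwalk : ∀ k ≤ N, 0 ≤ walk t σ k ω := fun k hk => by
      rcases Nat.eq_zero_or_pos k with rfl | hk0
      · simp [walk]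
      · exact (hserved k hk0 hk).le
    have hcmp := fun k => walk_add_le_psum (t := t) (σ := σ) l A k ω
    refine Set.mem_iUnion.2 ⟨N, N, le_rfl, fun k hk => ?_, fun k hk => ?_, ?_⟩
    · have h1 : psum σ 0 ω ≤ psum σ k ω := psum_mono hσ (Nat.zero_le k)
      rw [psum_zero] at h1
      have h2 : 0 ≤ (l - 1) * psum σ k ω := mul_nonneg (by linarith) h1
      linarith [hcmp k, hwalk k hk]
    · have h1 : σ k ω ≤ η * x := hjump k <| (add_one_le_numServed_iff k).2
        fun j hj hjk => hserved j hj (by omega)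
      have h2 : 0 ≤ min (t k ω) A := le_min (ht k) hA
      have h3 := mul_le_mul_of_nonneg_left h1 hl0.le
      have h4 := mul_le_mul_of_nonneg_right hηl hx0.le
      simp only [hξ, hz]
      linarith
    · have h1 : σ N ω ≤ η * x := hjump N hNτ
      have h2 : x / 2 < psum σ N ω := by nlinarith
      have h3 : (l - 1) * (x / 2) < (l - 1) * psum σ N ω :=
        mul_lt_mul_of_pos_left h2 (by linarith)
      simp only [hz]
      linarith [hcmp N, hwalk N le_rfl]
  have ho : (fun x => 2 * K * A * K * G ((l - 1) / 6 * x)) =o[atTop] fun _ => (1 : ℝ) := by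
    rw [isLittleO_one_iff]
    simpa using hGlim.const_mul (2 * K * A * K)
  have hO := hIRV.isBigO (r := 1 / l * ((l - 1) / 6)) (s := 1) (by positivity) one_pos
  have hmul := hO.mul_isLittleO ho
  simp only [one_mul, mul_one] at hmul
  refine IsBigO.trans_isLittleO (IsBigO.of_bound 1 ?_) hmul
  filter_upwards [hbound] with x hx
  rw [one_mul, Real.norm_eq_abs, abs_of_nonneg measureReal_nonneg]
  exact hx.trans (le_abs_self _)

end IsStableQueue

section LawOfLargeNumbers

lemma exists_linear_error {u : ℕ → ℝ} {c e : ℝ} (he : 0 < e)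
    (h : Tendsto (fun k : ℕ => u k / k) atTop (𝓝 c)) : ∃ M, ∀ k : ℕ, |u k - c * k| ≤ e * k + M := by
  obtain ⟨k₀, hk₀⟩ := eventually_atTop.1 ((Metric.tendsto_nhds.1 h e he))
  refine ⟨∑ j ∈ Finset.range (k₀ + 1), |u j - c * j|, fun k => ?_⟩
  have hS : 0 ≤ ∑ j ∈ Finset.range (k₀ + 1), |u j - c * j| := Finset.sum_nonneg fun _ _ => abs_nonneg _
  rcases le_or_gt k k₀ with hk | hk
  · have h1 := Finset.single_le_sum (f := fun j : ℕ => |u j - c * j|) (fun _ _ => abs_nonneg _)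
      (Finset.mem_range.2 (Nat.lt_succ_of_le hk))
    have h2 : 0 ≤ e * k := by positivity
    linarith
  · have hk0 : (0 : ℝ) < k := by exact_mod_cast (Nat.zero_le k₀).trans_lt hk
    have h1 := hk₀ k hk.le
    rw [Real.dist_eq] at h1
    have h2 : u k - c * k = (u k / k - c) * k := by field_simp
    rw [h2, abs_mul, abs_of_pos hk0]
    nlinarith

lemma sum_erase_add_ite {Ω : Type*} {σ : ℕ → Ω → ℝ} (n k : ℕ) (ω : Ω) :
    ∑ i ∈ (Finset.range k).erase n, σ i ω + (if n < k then σ n ω else 0) = psum σ k ω := by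
  by_cases h : n < k
  · rw [if_pos h, psum, Finset.sum_erase_add _ _ (Finset.mem_range.2 h)]
  · rw [if_neg h, add_zero, Finset.erase_eq_of_notMem (by simpa using h), psum]

variable {Ω : Type*} [mΩ : MeasurableSpace Ω]

/-- Deviation from the law of large numbers on the scale `x`: for some `k`, the total service time
of the first `k` customers, with customer `n` left out, or the `k`-th arrival time is off its mean
value by more than `e (a k + x)`. -/
def deviation (P : Measure Ω) (t σ : ℕ → Ω → ℝ) (n : ℕ) (e x : ℝ) : Set Ω :=
  {ω | ∃ k : ℕ, e * ((∫ ω, t 0 ω ∂P) * k + x) <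
      |∑ i ∈ (Finset.range k).erase n, σ i ω - (∫ ω, σ 0 ω ∂P) * k| ∨
    e * ((∫ ω, t 0 ω ∂P) * k + x) < |arrival t k ω - (∫ ω, t 0 ω ∂P) * k|}

lemma measurableSet_info_deviation (P : Measure Ω) (t σ : ℕ → Ω → ℝ) (n : ℕ) (e x : ℝ) :
    MeasurableSet[info t σ {j | j ≠ Sum.inl n}] (deviation P t σ n e x) := by
  rw [deviation, Set.ofPred_exists]
  refine MeasurableSet.iUnion fun k => ?_
  have h1 : Measurable[info t σ {j | j ≠ Sum.inl n}]
      (fun ω => ∑ i ∈ (Finset.range k).erase n, σ i ω) :=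
    Finset.measurable_fun_sum _ fun i hi => measurable_info_σ (by simpa using Finset.ne_of_mem_erase hi)
  have h2 : Measurable[info t σ {j | j ≠ Sum.inl n}] (arrival t k) :=
    Finset.measurable_fun_sum _ fun i _ => measurable_info_t (by simp)
  have h3 : ∀ c : ℝ, Measurable fun y : ℝ => |y - c| := fun c => by fun_prop
  exact (((h3 _).comp h1) measurableSet_Ioi).union (((h3 _).comp h2) measurableSet_Ioi)

namespace IsStableQueue

variable {P : Measure Ω} [IsProbabilityMeasure P]
  {t σ : ℕ → Ω → ℝ} (hQ : IsStableQueue P t σ)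
include hQ

lemma tendsto_prob_deviation (n : ℕ) {e : ℝ} (he : 0 < e) :
    Tendsto (fun x => P.real (deviation P t σ n e x)) atTop (𝓝 0) := by
  set a := ∫ ω, t 0 ω ∂P with ha
  set b := ∫ ω, σ 0 ω ∂P with hb
  have ha0 : 0 < a := hQ.mean_t_pos
  have hlln1 := strong_law_ae_real σ hQ.integrable_σ
    (fun i j hij => hQ.indep.indepFun (i := Sum.inl i) (j := Sum.inl j) (by simpa using hij))
    hQ.identDistrib_σ
  have hlln2 := strong_law_ae_real t hQ.integrable_t
    (fun i j hij => hQ.indep.indepFun (i := Sum.inr i) (j := Sum.inr j) (by simpa using hij))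
    hQ.identDistrib_t
  have h := tendsto_measure_of_ae_tendsto_indicator_of_isFiniteMeasure (μ := P) (atTop : Filter ℝ)
    (As := fun x => deviation P t σ n e x) MeasurableSet.empty
    (fun x => hQ.info_le _ _ (measurableSet_info_deviation P t σ n e x)) (by
      filter_upwards [hlln1, hlln2] with ω h1 h2
      obtain ⟨M₁, hM₁⟩ := exists_linear_error (e := e * a) (by positivity) h1
      obtain ⟨M₂, hM₂⟩ := exists_linear_error (e := e * a) (by positivity) h2
      filter_upwards [eventually_ge_atTop ((M₁ + |σ n ω|) / e), eventually_ge_atTop (M₂ / e)]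
        with x hx1 hx2
      rw [div_le_iff₀' he] at hx1 hx2
      simp only [Set.mem_empty_iff_false, iff_false, deviation, Set.mem_ofPred_eq, not_exists, not_or,
        not_lt]
      refine fun k => ⟨?_, ?_⟩
      · have h3 := sum_erase_add_ite (σ := σ) n k ω
        have h4 := hM₁ k
        change |psum σ k ω - b * k| ≤ _ at h4
        have h5 : |if n < k then σ n ω else 0| ≤ |σ n ω| := by
          split_ifs
          · rfl
          · simp
        have h6 : ∑ i ∈ (Finset.range k).erase n, σ i ω - b * k =
            (psum σ k ω - b * k) - (if n < k then σ n ω else 0) := by linarith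
        rw [h6]
        have h7 := abs_sub (psum σ k ω - b * k) (if n < k then σ n ω else 0)
        nlinarith
      · have h4 := hM₂ k
        change |arrival t k ω - a * k| ≤ _ at h4
        nlinarith)
  rw [measure_empty] at h
  exact (ENNReal.tendsto_toReal ENNReal.zero_ne_top).comp h

end IsStableQueue

end LawOfLargeNumbers

/-! ### Busy periods with one large service time -/

lemma measureReal_iUnion_le_tsum {Ω : Type*} [MeasurableSpace Ω] {P : Measure Ω} [IsFiniteMeasure P]
    {E : ℕ → Set Ω} {f : ℕ → ℝ} (hf : Summable f) (h : ∀ n, P.real (E n) ≤ f n) :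
    P.real (⋃ n, E n) ≤ ∑' n, f n := by
  have h0 : ∀ n, 0 ≤ f n := fun n => measureReal_nonneg.trans (h n)
  refine ENNReal.toReal_le_of_le_ofReal (tsum_nonneg h0) ((measure_iUnion_le E).trans ?_)
  rw [ENNReal.ofReal_tsum_of_nonneg h0 hf]
  exact ENNReal.tsum_le_tsum fun n => (ENNReal.le_ofReal_iff_toReal_le (measure_ne_top _ _) (h0 n)).2 (h n)

namespace IsStableQueue

variable {Ω : Type*} [mΩ : MeasurableSpace Ω] {P : Measure Ω}
  {t σ : ℕ → Ω → ℝ} (hQ : IsStableQueue P t σ)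
include hQ

/-- On the scale of the law of large numbers, a service time below `(1 - δ) (1 - ρ) x` does not
make the busy period longer than `x`: with all other customers behaving as on average, the work
brought in by time `x` is done before time `x`. -/
lemma busyPeriod_le_of_small {δ e x : ℝ} (he : 0 < e) (he1 : e ≤ 1)
    (heδ : e ≤ δ * (1 - rho P t σ) / 10) (hx0 : 0 < x)
    (hx : 10 * (∫ ω, t 0 ω ∂P) ≤ δ * (1 - rho P t σ) * x) {n : ℕ} {ω : Ω} (hσ : ∀ n, 0 ≤ σ n ω)
    (hτ : numServed t σ ω ≠ ⊤) (hdev : ω ∉ deviation P t σ n e x)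
    (hn : σ n ω ≤ (1 - δ) * (1 - rho P t σ) * x) : busyPeriod t σ ω ≤ (x : EReal) := by
  set a := ∫ ω, t 0 ω ∂P with ha
  set b := ∫ ω, σ 0 ω ∂P with hb
  set r := rho P t σ with hr
  have ha0 : 0 < a := hQ.mean_t_pos
  have hr0 : 0 < r := hQ.rho_pos
  have hr1 : r < 1 := hQ.rho_lt_one
  have hab : b = r * a := by simp only [hr, rho, ← ha, ← hb]; field_simp
  simp only [deviation, Set.mem_ofPred_eq, not_exists, not_or, not_lt, ← ha, ← hb] at hdev
  obtain ⟨N, hN, hNτ⟩ := exists_first_return hτ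
  rw [busyPeriod_eq hσ hN hNτ, EReal.coe_le_coe_iff]
  by_contra! hlt
  -- the number of arrivals by time `x`
  obtain ⟨m, hm1, hm2⟩ : ∃ m : ℕ, x ≤ a * m ∧ a * m ≤ x + a := by
    refine ⟨⌈x / a⌉₊, ?_, ?_⟩
    · have := Nat.le_ceil (x / a)
      rwa [div_le_iff₀' ha0] at this
    · have := (Nat.ceil_lt_add_one (show 0 ≤ x / a by positivity)).le
      calc a * ⌈x / a⌉₊ ≤ a * (x / a + 1) := by gcongr
        _ = x + a := by field_simp
  have hm0 : 1 ≤ m := by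
    by_contra! h0
    have : m = 0 := by omega
    subst this
    simp at hm1
    linarith
  have h1 := (abs_le.1 (hdev m).1).2
  have h2 := (abs_le.1 (hdev m).2).1
  have h3 := sum_erase_add_ite (σ := σ) n m ω
  have h4 : (if n < m then σ n ω else 0) ≤ (1 - δ) * (1 - r) * x := by
    split_ifs
    · exact hn
    · exact (hσ n).trans hn
  have h5 : e * (a * m + x) ≤ e * (2 * x + a) :=
    mul_le_mul_of_nonneg_left (by linarith) he.le
  have h6 : b * m ≤ r * (x + a) := by
    rw [hab, mul_assoc]; gcongr
  have h7 : e * x ≤ δ * (1 - r) / 10 * x := by gcongr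
  have h8 : e * a ≤ a := by nlinarith
  have h9 : r * a ≤ a := by nlinarith
  rcases le_or_gt (N + 1) m with hmN | hmN
  · have h10 : psum σ (N + 1) ω ≤ psum σ m ω := psum_mono hσ hmN
    linarith
  · have h10 := (add_one_le_numServed_iff N).1 hNτ m hm0 (by omega)
    rw [walk_eq_sub] at h10
    linarith

/-- On the scale of the law of large numbers, a service time above `(1 + δ) (1 - ρ) x` in the first
busy period makes it longer than `x`. -/
lemma lt_busyPeriod_of_large {δ e x : ℝ} (he : 0 < e) (hδ1 : δ ≤ 1)
    (heδ : e ≤ δ * (1 - rho P t σ) * rho P t σ / 20) (hx0 : 0 < x) {n : ℕ} {ω : Ω}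
    (hσ : ∀ n, 0 ≤ σ n ω)
    (hτ : numServed t σ ω ≠ ⊤) (hdev : ω ∉ deviation P t σ n e x)
    (hserved : ((n + 1 : ℕ) : ℕ∞) ≤ numServed t σ ω)
    (hn : (1 + δ) * (1 - rho P t σ) * x < σ n ω) : (x : EReal) < busyPeriod t σ ω := by
  set a := ∫ ω, t 0 ω ∂P with ha
  set b := ∫ ω, σ 0 ω ∂P with hb
  set r := rho P t σ with hr
  have ha0 : 0 < a := hQ.mean_t_pos
  have hr0 : 0 < r := hQ.rho_pos
  have hr1 : r < 1 := hQ.rho_lt_one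
  have hab : b = r * a := by simp only [hr, rho, ← ha, ← hb]; field_simp
  simp only [deviation, Set.mem_ofPred_eq, not_exists, not_or, not_lt, ← ha, ← hb] at hdev
  obtain ⟨N, hN, hNτ⟩ := exists_first_return hτ
  rw [busyPeriod_eq hσ hN hNτ, EReal.coe_lt_coe_iff]
  by_contra! hle
  rw [walk_eq_sub] at hN
  have hnN : n < N + 1 := by
    by_contra! hlt
    have := (add_one_le_numServed_iff n).1 hserved (N + 1) (by omega) hlt
    rw [walk_eq_sub] at this
    linarith
  have h1 := (abs_le.1 (hdev (N + 1)).1).1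
  have h2 := (abs_le.1 (hdev (N + 1)).2).2
  have h3 := sum_erase_add_ite (σ := σ) n (N + 1) ω
  rw [if_pos hnN] at h3
  set u := a * ((N + 1 : ℕ) : ℝ) with hu
  have hu0 : 0 < u := by positivity
  have hbu : b * ((N + 1 : ℕ) : ℝ) = r * u := by rw [hab, hu]; ring
  rw [hbu] at h1
  -- the service times add up to at most `x`
  have hi : r * u - e * (u + x) + (1 + δ) * (1 - r) * x ≤ x := by linarith
  -- and they do not exceed the arrival time that ends the busy period
  have hii : r * u - e * (u + x) + (1 + δ) * (1 - r) * x ≤ u + e * (u + x) := by linarith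
  have hδ0 : 0 < δ := by
    by_contra! hneg
    have : δ * (1 - r) * r ≤ 0 :=
      mul_nonpos_of_nonpos_of_nonneg (mul_nonpos_of_nonpos_of_nonneg hneg (by linarith)) hr0.le
    linarith
  have hc0 : 0 < 1 - r := by linarith
  have hc1 : 1 - r ≤ 1 := by linarith
  have hδr : δ * (1 - r) ≤ 1 := mul_le_one₀ hδ1 hc0.le hc1
  have her : e ≤ r / 20 := by
    have := mul_le_mul_of_nonneg_right hδr hr0.le
    linarith
  have hru : r * u ≤ 4 * x := by
    have h5 : e * u ≤ r / 20 * u := by gcongr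
    have h6 : e * x ≤ 1 * x := by gcongr; linarith
    have h7 : 0 ≤ (1 + δ) * (1 - r) * x := by positivity
    have h8 : 0 ≤ r * u := by positivity
    linarith
  have heu : e * u ≤ δ * (1 - r) / 5 * x := by
    have h5 : e * u ≤ δ * (1 - r) * r / 20 * u := by gcongr
    have h6 : δ * (1 - r) / 20 * (r * u) ≤ δ * (1 - r) / 20 * (4 * x) := by gcongr
    linarith
  have hex : e * x ≤ δ * (1 - r) / 20 * x := by
    have h5 : δ * (1 - r) * r ≤ δ * (1 - r) * 1 := by gcongr
    have h6 : e ≤ δ * (1 - r) / 20 := by linarith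
    gcongr
  have hpos : 0 < δ * (1 - r) * x := by positivity
  have hE0 : 0 < e * (u + x) := by positivity
  have hE : e * (u + x) = e * u + e * x := by ring
  set E := e * (u + x)
  have hrE : r * E ≤ 1 * E := by gcongr
  -- the convex combination of both bounds with weights `1 - r` and `r`
  have hkey : δ * (1 - r) * x ≤ E + r * E := by
    have hi' := mul_le_mul_of_nonneg_left hi hc0.le
    have hii' := mul_le_mul_of_nonneg_left hii hr0.le
    linarith
  linarith

end IsStableQueue

/-! ### The principle of a single big jump -/

/-- The event that some customer of the first busy period has a service time above `y`. -/
def bigService {Ω : Type*} (t σ : ℕ → Ω → ℝ) (y : ℝ) : Set Ω :=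
  ⋃ n : ℕ, {ω | ((n + 1 : ℕ) : ℕ∞) ≤ numServed t σ ω ∧ y < σ n ω}

/-- The event that the first busy period is longer than `x`. -/
def longBusy {Ω : Type*} (t σ : ℕ → Ω → ℝ) (x : ℝ) : Set Ω :=
  {ω | (x : EReal) < busyPeriod t σ ω}

namespace IsStableQueue

variable {Ω : Type*} [mΩ : MeasurableSpace Ω] {P : Measure Ω}
  {t σ : ℕ → Ω → ℝ} (hQ : IsStableQueue P t σ)
include hQ

lemma prob_served_gt (n : ℕ) (y : ℝ) :
    P.real {ω | ((n + 1 : ℕ) : ℕ∞) ≤ numServed t σ ω ∧ y < σ n ω} =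
      P.real {ω | ((n + 1 : ℕ) : ℕ∞) ≤ numServed t σ ω} * tail (P.map (σ 0)) y := by
  rw [← hQ.tail_eq n]
  exact hQ.prob_served_inter n (E := Set.Ioi y) measurableSet_Ioi

lemma one_sub_rho_pos : 0 < 1 - rho P t σ := by linarith [hQ.rho_lt_one]

lemma tendsto_mul_one_sub_rho : Tendsto (fun x : ℝ => (1 - rho P t σ) * x) atTop atTop :=
  tendsto_id.const_mul_atTop hQ.one_sub_rho_pos

variable [IsProbabilityMeasure P]

lemma prob_bigService_le (y : ℝ) : P.real (bigService t σ y) ≤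
    (∑' n : ℕ, P.real {ω | ((n + 1 : ℕ) : ℕ∞) ≤ numServed t σ ω}) * tail (P.map (σ 0)) y := by
  rw [← tsum_mul_right]
  exact measureReal_iUnion_le_tsum (hQ.summable_served.mul_right _) fun n => (hQ.prob_served_gt n y).le

/-- A Bonferroni bound for the first `N` customers: two service times are large with the square of
the probability that one is. -/
lemma le_prob_bigService (N : ℕ) (y : ℝ) :
    (∑ n ∈ Finset.range N, P.real {ω | ((n + 1 : ℕ) : ℕ∞) ≤ numServed t σ ω}) *
      tail (P.map (σ 0)) y ≤ P.real (bigService t σ y) + N * (N * tail (P.map (σ 0)) y ^ 2) := by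
  set H := tail (P.map (σ 0)) y with hH
  set B : ℕ → Set Ω := fun n => {ω | ((n + 1 : ℕ) : ℕ∞) ≤ numServed t σ ω ∧ y < σ n ω} with hB
  -- customer `n` is the only one among the first `N` with a large service time
  set B' : ℕ → Set Ω := fun n => B n ∩ {ω | ∀ k < N, k ≠ n → σ k ω ≤ y} with hB'
  have hσ := hQ.measurable_σ
  have hBm : ∀ n, MeasurableSet (B n) := fun n =>
    (hQ.measurableSet_served n).inter (measurableSet_lt measurable_const (hσ n))
  have hBm' : ∀ n, MeasurableSet (B' n) := fun n => by
    refine (hBm n).inter ?_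
    measurability
  have hpair : ∀ n k, k ≠ n → P.real ({ω | y < σ n ω} ∩ {ω | y < σ k ω}) = H ^ 2 := fun n k hkn => by
    rw [hQ.measureReal_inter (J := {Sum.inl n}) (J' := {Sum.inl k}) (E := {ω | y < σ n ω})
      (F := {ω | y < σ k ω}) (by simpa using hkn.symm)
      (measurable_info_σ (t := t) (Set.mem_singleton _) measurableSet_Ioi)
      (measurable_info_σ (t := t) (Set.mem_singleton _) measurableSet_Ioi), hQ.tail_eq, hQ.tail_eq, sq]
  have hle : ∀ n ∈ Finset.range N, P.real {ω | ((n + 1 : ℕ) : ℕ∞) ≤ numServed t σ ω} * H ≤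
      P.real (B' n) + N * H ^ 2 := fun n _ => by
    rw [← hQ.prob_served_gt n y]
    have hsub : B n ⊆ B' n ∪ ⋃ k ∈ (Finset.range N).erase n, {ω | y < σ n ω} ∩ {ω | y < σ k ω} := by
      intro ω hω
      by_cases h : ∀ k < N, k ≠ n → σ k ω ≤ y
      · exact Or.inl ⟨hω, h⟩
      · push Not at h
        obtain ⟨k, hk, hkn, hy⟩ := h
        refine Or.inr (Set.mem_iUnion₂.2 ⟨k, Finset.mem_erase.2 ⟨hkn, Finset.mem_range.2 hk⟩, hω.2, hy⟩)
    calc P.real (B n) ≤ _ := measureReal_mono hsub (measure_ne_top _ _)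
      _ ≤ P.real (B' n) + P.real (⋃ k ∈ (Finset.range N).erase n, {ω | y < σ n ω} ∩ {ω | y < σ k ω}) :=
          measureReal_union_le _ _
      _ ≤ P.real (B' n) + ∑ k ∈ (Finset.range N).erase n, P.real ({ω | y < σ n ω} ∩ {ω | y < σ k ω}) := by
          gcongr
          exact measureReal_biUnion_finset_le _ _
      _ = P.real (B' n) + ∑ k ∈ (Finset.range N).erase n, H ^ 2 := by
          congr 1
          exact Finset.sum_congr rfl fun k hk => hpair n k (Finset.ne_of_mem_erase hk)
      _ ≤ P.real (B' n) + ∑ k ∈ Finset.range N, H ^ 2 := by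
          refine add_le_add le_rfl ?_
          exact Finset.sum_le_sum_of_subset_of_nonneg (Finset.erase_subset _ _)
            fun _ _ _ => sq_nonneg _
      _ = _ := by simp
  have hdisj : (Finset.range N : Set ℕ).PairwiseDisjoint B' := fun n hn k hk hnk =>
    Set.disjoint_left.2 fun ω hωn hωk =>
      absurd hωn.1.2 (not_lt.2 (hωk.2 n (by simpa using hn) hnk))
  rw [Finset.sum_mul]
  calc _ ≤ ∑ n ∈ Finset.range N, (P.real (B' n) + N * H ^ 2) := Finset.sum_le_sum hle
    _ = P.real (⋃ n ∈ Finset.range N, B' n) + N * (N * H ^ 2) := by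
        rw [Finset.sum_add_distrib, measureReal_biUnion_finset hdisj fun n _ => hBm' n]
        simp
    _ ≤ _ := by
        gcongr
        · exact measure_ne_top _ _
        · exact Set.iUnion₂_subset fun n _ => Set.inter_subset_left.trans (Set.subset_iUnion B n)

/-- `P (some large service time in the busy period) ∼ E τ · P (one service time is large)`. -/
lemma bigService_sub_isLittleO (hIRV : IsIRV (P.map (σ 0))) :
    (fun y => P.real (bigService t σ y) -
      (∑' n : ℕ, P.real {ω | ((n + 1 : ℕ) : ℕ∞) ≤ numServed t σ ω}) * tail (P.map (σ 0)) y)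
      =o[atTop] fun y => tail (P.map (σ 0)) y := by
  have := hQ.isProbabilityMeasure_map
  set p : ℕ → ℝ := fun n => P.real {ω | ((n + 1 : ℕ) : ℕ∞) ≤ numServed t σ ω} with hp
  refine isLittleO_iff.2 fun ε hε => ?_
  obtain ⟨N, hN⟩ := (hQ.summable_served.hasSum.tendsto_sum_nat.eventually
    (lt_mem_nhds (show ∑' n, p n - ε / 2 < ∑' n, p n by linarith))).exists
  have hlim : Tendsto (fun y => (N : ℝ) * (N * tail (P.map (σ 0)) y)) atTop (𝓝 0) := by
    simpa using ((tendsto_tail (P.map (σ 0))).const_mul (N : ℝ)).const_mul (N : ℝ)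
  filter_upwards [hlim.eventually (gt_mem_nhds (show 0 < ε / 2 by linarith))] with y hy
  have hH := hIRV.1 y
  have h1 := hQ.prob_bigService_le y
  have h2 := hQ.le_prob_bigService N y
  rw [Real.norm_eq_abs, Real.norm_eq_abs, abs_of_pos hH, abs_of_nonpos (by linarith)]
  have h3 := mul_le_mul_of_nonneg_right hN.le hH.le
  have h4 := mul_le_mul_of_nonneg_right hy.le hH.le
  linarith

/-- The principle of a single big jump: a long busy period and a large service time in it are
the same event up to negligible probability. Outside of the event without big jump, the symmetric
difference requires a large service time of a late customer (improbable because `E τ < ∞`), or one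
close to `(1 - ρ) x` (improbable because the tail is intermediate regularly varying), or a
large one together with an independent deviation from the law of large numbers. -/
lemma symmDiff_isLittleO (hIRV : IsIRV (P.map (σ 0))) :
    (fun x => P.real (symmDiff (longBusy t σ x) (bigService t σ ((1 - rho P t σ) * x))))
      =o[atTop] fun x => tail (P.map (σ 0)) ((1 - rho P t σ) * x) := by
  have := hQ.isProbabilityMeasure_map
  set c := 1 - rho P t σ with hc
  have hc0 : 0 < c := hQ.one_sub_rho_pos
  set H := tail (P.map (σ 0)) with hH
  set p : ℕ → ℝ := fun n => P.real {ω | ((n + 1 : ℕ) : ℕ∞) ≤ numServed t σ ω} with hp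
  obtain ⟨η₀, hη₀, hD⟩ := hQ.prob_no_big_jump hIRV
  set η := min η₀ c with hη
  have hη0 : 0 < η := lt_min hη₀ hc0
  have hD' := hD.trans_isBigO (by simpa using hIRV.isBigO one_pos hc0)
  obtain ⟨M, hM0, hM⟩ := (hIRV.isBigO hη0 hc0).exists_pos
  refine isLittleO_iff.2 fun ε hε => ?_
  obtain ⟨N, hN⟩ := ((tendsto_sum_nat_add p).eventually
    (gt_mem_nhds (show 0 < ε / 4 / M by positivity))).exists
  obtain ⟨δ, hδ0, hδ1, hδ⟩ := hIRV.exists_contraction (ε := ε / (8 * (N + 1))) (by positivity)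
  obtain ⟨e, he0, he⟩ : ∃ e, 0 < e ∧ e = min 1 (δ * c * rho P t σ / 20) :=
    ⟨_, lt_min one_pos (by have := hQ.rho_pos
                           positivity), rfl⟩
  have he1 : e ≤ 1 := he ▸ min_le_left _ _
  have he2 : e ≤ δ * c * rho P t σ / 20 := he ▸ min_le_right _ _
  have he3 : e ≤ δ * c / 10 := by
    have : δ * c * rho P t σ ≤ δ * c * 1 := by
      gcongr
      exact hQ.rho_lt_one.le
    have : 0 < δ * c := by positivity
    linarith
  have hdev : Tendsto (fun x => ∑ n ∈ Finset.range N, P.real (deviation P t σ n e x)) atTop (𝓝 0) := by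
    simpa using tendsto_finsetSum (Finset.range N) fun n _ => hQ.tendsto_prob_deviation n he0
  filter_upwards [hM.bound, isLittleO_iff.1 hD' (show 0 < ε / 4 by positivity),
    hQ.tendsto_mul_one_sub_rho.eventually hδ,
    hdev.eventually (gt_mem_nhds (show 0 < ε / 4 / M by positivity)), eventually_gt_atTop 0,
    (tendsto_id.const_mul_atTop (show 0 < δ * c by positivity)).eventually_ge_atTop
      (10 * ∫ ω, t 0 ω ∂P)] with x hMx hDx hδx hdevx hx0 hxa
  have hHc : 0 < H (c * x) := hIRV.1 _
  have hHη : 0 < H (η * x) := hIRV.1 _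
  rw [Real.norm_eq_abs, Real.norm_eq_abs, abs_of_pos hHc] at hMx hDx ⊢
  rw [abs_of_nonneg measureReal_nonneg] at hDx ⊢
  rw [abs_of_pos hHη] at hMx
  set D := {ω | (x : EReal) < busyPeriod t σ ω ∧
    ∀ n : ℕ, ((n + 1 : ℕ) : ℕ∞) ≤ numServed t σ ω → σ n ω ≤ η₀ * x} with hDdef
  set late := ⋃ n : ℕ, {ω | ((n + N + 1 : ℕ) : ℕ∞) ≤ numServed t σ ω ∧ η * x < σ (n + N) ω} with hlate
  set near := fun n : ℕ => {ω | (1 - δ) * (c * x) < σ n ω} \ {ω | (1 + δ) * (c * x) < σ n ω} with hnear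
  set dev := fun n : ℕ => {ω | η * x < σ n ω} ∩ deviation P t σ n e x with hdevdef
  have hsub : ∀ᵐ ω ∂P, ω ∈ symmDiff (longBusy t σ x) (bigService t σ (c * x)) →
      ω ∈ D ∪ (late ∪ ⋃ n ∈ Finset.range N, (near n ∪ dev n)) := by
    filter_upwards [hQ.ae_nonneg, hQ.ae_numServed_ne_top] with ω ⟨hσ, ht⟩ hτ hω
    -- a customer of the busy period with large service time, for which not exactly one of the
    -- events occurs
    have key : ∀ n : ℕ, ((n + 1 : ℕ) : ℕ∞) ≤ numServed t σ ω → η * x < σ n ω →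
        (busyPeriod t σ ω ≤ (x : EReal) → (1 - δ) * c * x < σ n ω) →
        ((x : EReal) < busyPeriod t σ ω → σ n ω ≤ (1 + δ) * c * x) →
        ω ∈ D ∪ (late ∪ ⋃ n ∈ Finset.range N, (near n ∪ dev n)) := by
      intro n hn hbig h1 h2
      rcases le_or_gt N n with hNn | hNn
      · refine Or.inr (Or.inl (Set.mem_iUnion.2 ⟨n - N, ?_⟩))
        rw [Set.mem_ofPred_eq, Nat.sub_add_cancel hNn]
        exact ⟨hn, hbig⟩
      · refine Or.inr (Or.inr (Set.mem_iUnion₂.2 ⟨n, Finset.mem_range.2 hNn, ?_⟩))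
        by_cases hd : ω ∈ deviation P t σ n e x
        · exact Or.inr ⟨hbig, hd⟩
        · refine Or.inl ⟨?_, ?_⟩
          · by_contra hsmall
            simp only [Set.mem_ofPred_eq, not_lt, ← mul_assoc] at hsmall
            exact absurd (h1 (hQ.busyPeriod_le_of_small he0 he1 he3 hx0 hxa hσ hτ hd hsmall))
              (not_lt.2 hsmall)
          · intro hlarge
            simp only [Set.mem_ofPred_eq, ← mul_assoc] at hlarge
            exact absurd (h2 (hQ.lt_busyPeriod_of_large he0 (by linarith) he2 hx0 hσ hτ hd hn hlarge))
              (not_le.2 hlarge)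
    have hηx : η * x ≤ c * x := by gcongr; exact min_le_right _ _
    have hηx' : η * x ≤ η₀ * x := by gcongr; exact min_le_left _ _
    have hδc : 0 ≤ δ * c * x := by positivity
    rcases hω with ⟨hlong, hnot⟩ | ⟨hbig, hnot⟩
    · by_cases hωD : ω ∈ D
      · exact Or.inl hωD
      · obtain ⟨n, hn, hσn⟩ : ∃ n : ℕ, ((n + 1 : ℕ) : ℕ∞) ≤ numServed t σ ω ∧ η₀ * x < σ n ω := by
          by_contra! hno
          exact hωD ⟨hlong, hno⟩
        have hσc : σ n ω ≤ c * x := by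
          by_contra! hlt
          exact hnot (Set.mem_iUnion.2 ⟨n, hn, hlt⟩)
        exact key n hn (by linarith) (fun h => absurd hlong (not_lt.2 h)) fun _ => by linarith
    · obtain ⟨n, hn, hσn⟩ := Set.mem_iUnion.1 hbig
      exact key n hn (by linarith) (fun _ => by linarith) fun h => absurd h hnot
  have hPlate : P.real late ≤ ε / 4 * H (c * x) := by
    calc P.real late ≤ ∑' n, p (n + N) * H (η * x) :=
          measureReal_iUnion_le_tsum (((summable_nat_add_iff N).2 hQ.summable_served).mul_right _)
            fun n => (hQ.prob_served_gt (n + N) (η * x)).le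
      _ = (∑' n, p (n + N)) * H (η * x) := tsum_mul_right
      _ ≤ ε / 4 / M * (M * H (c * x)) := by gcongr
      _ = _ := by field_simp
  have hPnear : ∀ n, P.real (near n) ≤ 2 * (ε / (8 * (N + 1))) * H (c * x) := fun n => by
    have hsub' : {ω | (1 + δ) * (c * x) < σ n ω} ⊆ {ω | (1 - δ) * (c * x) < σ n ω} := by
      intro ω hω
      have hδc : 0 ≤ δ * (c * x) := by positivity
      simp only [Set.mem_ofPred_eq] at hω ⊢
      linarith
    rw [hnear, measureReal_sdiff hsub' (measurableSet_lt measurable_const (hQ.measurable_σ n)),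
      hQ.tail_eq, hQ.tail_eq]
    set ε' := ε / (8 * (N + 1))
    have hε' : 0 < ε' := by positivity
    obtain ⟨h1, h2⟩ := hδx
    have h3 : H ((1 + δ) * (c * x)) ≤ H (c * x) := by
      apply tail_antitone
      have : 0 ≤ δ * (c * x) := by positivity
      linarith
    have h4 := mul_le_mul_of_nonneg_left h3 hε'.le
    change H _ - H _ ≤ _
    linarith
  have hPdev : ∀ n, P.real (dev n) = H (η * x) * P.real (deviation P t σ n e x) := fun n => by
    change _ = tail (P.map (σ 0)) _ * _
    rw [← hQ.tail_eq n]
    exact hQ.measureReal_inter (J := {Sum.inl n}) (by simp)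
      (measurable_info_σ (t := t) (Set.mem_singleton _) measurableSet_Ioi)
      (measurableSet_info_deviation P t σ n e x)
  have hPfin : P.real (⋃ n ∈ Finset.range N, (near n ∪ dev n)) ≤ ε / 2 * H (c * x) := by
    calc P.real (⋃ n ∈ Finset.range N, (near n ∪ dev n))
        ≤ ∑ n ∈ Finset.range N, P.real (near n ∪ dev n) := measureReal_biUnion_finset_le _ _
      _ ≤ ∑ n ∈ Finset.range N, (2 * (ε / (8 * (N + 1))) * H (c * x) +
            H (η * x) * P.real (deviation P t σ n e x)) := by
          refine Finset.sum_le_sum fun n _ => (measureReal_union_le _ _).trans ?_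
          rw [hPdev]
          gcongr
          exact hPnear n
      _ = N * (2 * (ε / (8 * (N + 1))) * H (c * x)) +
            H (η * x) * ∑ n ∈ Finset.range N, P.real (deviation P t σ n e x) := by
          rw [Finset.sum_add_distrib, Finset.mul_sum]
          simp
      _ ≤ ε / 4 * H (c * x) + M * H (c * x) * (ε / 4 / M) := by
          have h1 : (N : ℝ) * (2 * (ε / (8 * (N + 1)))) ≤ ε / 4 := by
            rw [show (N : ℝ) * (2 * (ε / (8 * (N + 1)))) = ε / 4 * (N / (N + 1)) by field_simp; ring]
            have h2 : (N : ℝ) / (N + 1) ≤ 1 := by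
              rw [div_le_one (by positivity)]
              linarith
            nlinarith
          rw [← mul_assoc (N : ℝ)]
          gcongr
      _ = _ := by field_simp; ring
  calc P.real (symmDiff (longBusy t σ x) (bigService t σ (c * x)))
      ≤ P.real (D ∪ (late ∪ ⋃ n ∈ Finset.range N, (near n ∪ dev n))) :=
        ENNReal.toReal_mono (measure_ne_top _ _) (measure_mono_ae hsub)
    _ ≤ P.real D + (P.real late + P.real (⋃ n ∈ Finset.range N, (near n ∪ dev n))) :=
        (measureReal_union_le _ _).trans (by gcongr; exact measureReal_union_le _ _)
    _ ≤ ε / 4 * H (c * x) + (ε / 4 * H (c * x) + ε / 2 * H (c * x)) := by gcongr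
    _ = ε * H (c * x) := by ring

end IsStableQueue

/-! ### Asymptotics of the tail of the busy period -/

lemma asympGE_of_tendsto_div {f g : ℝ → ℝ} {L : ℝ} (hL : 1 ≤ L)
    (h : Tendsto (fun x => f x / g x) atTop (𝓝 L)) : AsympGE f g := by
  have h1 : Tendsto (fun x => ((f x / g x : ℝ) : EReal)) atTop (𝓝 (L : EReal)) :=
    (continuous_coe_real_ereal.tendsto L).comp h
  rw [AsympGE, h1.liminf_eq]
  exact_mod_cast hL

namespace IsStableQueue

variable {Ω : Type*} [mΩ : MeasurableSpace Ω] {P : Measure Ω}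
  {t σ : ℕ → Ω → ℝ} (hQ : IsStableQueue P t σ)
include hQ

lemma prob_bigService_ne_zero (hIRV : IsIRV (P.map (σ 0))) (y : ℝ) : P (bigService t σ y) ≠ 0 := by
  have h := hIRV.1 y
  rw [← hQ.tail_eq 0] at h
  intro h0
  refine h.ne' ?_
  rw [Measure.real, ENNReal.toReal_eq_zero_iff]
  left
  have hsub : {ω | y < σ 0 ω} ⊆ bigService t σ y := fun ω hω => by
    refine Set.mem_iUnion.2 ⟨0, (add_one_le_numServed_iff 0).2 fun k h1 h2 => ?_, hω⟩
    omega
  exact measure_mono_null hsub h0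

variable [IsProbabilityMeasure P]

lemma one_le_tsum_served :
    1 ≤ ∑' n : ℕ, P.real {ω | ((n + 1 : ℕ) : ℕ∞) ≤ numServed t σ ω} := by
  refine le_trans ?_ (hQ.summable_served.le_tsum 0 fun _ _ => measureReal_nonneg)
  have : {ω | ((0 + 1 : ℕ) : ℕ∞) ≤ numServed t σ ω} = Set.univ := by
    ext ω
    simp only [add_one_le_numServed_iff, Set.mem_ofPred_eq, Set.mem_univ, iff_true]
    intro k h1 h2
    omega
  rw [this, probReal_univ]

/-- `P (B > x) ∼ E τ · P (one service time is larger than (1 - ρ) x)`. -/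
lemma longBusy_div_tendsto (hIRV : IsIRV (P.map (σ 0))) :
    Tendsto (fun x => P.real (longBusy t σ x) / tail (P.map (σ 0)) ((1 - rho P t σ) * x)) atTop
      (𝓝 (∑' n : ℕ, P.real {ω | ((n + 1 : ℕ) : ℕ∞) ≤ numServed t σ ω})) := by
  set c := 1 - rho P t σ
  set m := ∑' n : ℕ, P.real {ω | ((n + 1 : ℕ) : ℕ∞) ≤ numServed t σ ω}
  have h1 := (hQ.symmDiff_isLittleO hIRV).tendsto_div_nhds_zero
  have h2 := ((hQ.bigService_sub_isLittleO hIRV).comp_tendsto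
    hQ.tendsto_mul_one_sub_rho).tendsto_div_nhds_zero
  have h3 : Tendsto (fun x => P.real (bigService t σ (c * x)) / tail (P.map (σ 0)) (c * x)) atTop
      (𝓝 m) := by
    have h4 := h2.add_const m
    rw [zero_add] at h4
    refine h4.congr fun x => ?_
    have := (hIRV.1 (c * x)).ne'
    simp only [Function.comp_apply]
    change (P.real (bigService t σ (c * x)) - m * tail (P.map (σ 0)) (c * x)) / tail (P.map (σ 0)) (c * x) + m = _
    field_simp
    ring
  have h5 : Tendsto (fun x => (P.real (longBusy t σ x) - P.real (bigService t σ (c * x))) /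
      tail (P.map (σ 0)) (c * x)) atTop (𝓝 0) := by
    refine squeeze_zero_norm (fun x => ?_) h1
    have hH := hIRV.1 (c * x)
    rw [Real.norm_eq_abs, abs_div, abs_of_pos hH]
    gcongr
    rw [abs_sub_le_iff]
    constructor
    · have : longBusy t σ x ⊆ bigService t σ (c * x) ∪
          symmDiff (longBusy t σ x) (bigService t σ (c * x)) := fun ω hω => by
        by_cases h : ω ∈ bigService t σ (c * x)
        · exact Or.inl h
        · exact Or.inr (Or.inl ⟨hω, h⟩)
      have := (measureReal_mono (μ := P) this).trans (measureReal_union_le _ _)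
      linarith
    · have : bigService t σ (c * x) ⊆ longBusy t σ x ∪
          symmDiff (longBusy t σ x) (bigService t σ (c * x)) := fun ω hω => by
        by_cases h : ω ∈ longBusy t σ x
        · exact Or.inl h
        · exact Or.inr (Or.inr ⟨hω, h⟩)
      have := (measureReal_mono (μ := P) this).trans (measureReal_union_le _ _)
      linarith
  have h6 := h5.add h3
  rw [zero_add] at h6
  refine h6.congr fun x => ?_
  rw [← add_div]
  ring

/-- An atom at the boundary does not matter: intermediate regularly varying tails do not change
asymptotically when the endpoint is included. -/
lemma tendsto_prob_ge_div (hIRV : IsIRV (P.map (σ 0))) :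
    Tendsto (fun y => P.real {ω | y ≤ σ 0 ω} / tail (P.map (σ 0)) y) atTop (𝓝 1) := by
  have := hQ.isProbabilityMeasure_map
  have hlow : ∀ y, 1 ≤ P.real {ω | y ≤ σ 0 ω} / tail (P.map (σ 0)) y := fun y => by
    rw [one_le_div (hIRV.1 y), ← hQ.tail_eq 0]
    exact measureReal_mono fun ω (hω : y < σ 0 ω) => hω.le
  refine Metric.tendsto_nhds.2 fun ε hε => ?_
  filter_upwards [hIRV.shift 1 (half_pos hε)] with y hy
  rw [Real.dist_eq, abs_of_nonneg (by linarith [hlow y])]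
  have h1 : P.real {ω | y ≤ σ 0 ω} ≤ tail (P.map (σ 0)) (y - 1) := by
    rw [← hQ.tail_eq 0]
    refine measureReal_mono fun ω (hω : y ≤ σ 0 ω) => ?_
    change y - 1 < σ 0 ω
    linarith
  have h2 : P.real {ω | y ≤ σ 0 ω} / tail (P.map (σ 0)) y ≤ 1 + ε / 2 := by
    rw [div_le_iff₀ (hIRV.1 y)]
    exact h1.trans hy
  linarith

lemma prob_longBusy_ne_zero (hIRV : IsIRV (P.map (σ 0))) (x : ℝ) : P (longBusy t σ x) ≠ 0 := by
  have h := hIRV.1 x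
  rw [← hQ.tail_eq 0] at h
  intro h0
  refine h.ne' ?_
  rw [Measure.real, ENNReal.toReal_eq_zero_iff]
  left
  have hle : P {ω | x < σ 0 ω} ≤ P (longBusy t σ x) := by
    refine measure_mono_ae ?_
    filter_upwards [hQ.ae_nonneg, hQ.ae_numServed_ne_top] with ω hω hτ hx
    refine lt_busyPeriod_of_lt hω.1 hτ ((add_one_le_numServed_iff 0).2 fun k h1 h2 => ?_) hx
    omega
  exact le_antisymm (hle.trans h0.le) zero_le

end IsStableQueue

end GIGI1

/-- Customer `n` here is the `(n+1)`st arriving customer, so `{n + 1 ≤ numServed, σ n > y}` is the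
event that the `(n+1)`st customer belongs to the first busy period and its service time is
larger than `y`. -/
theorem corollary3p1 {Ω : Type*} [MeasurableSpace Ω] (P : Measure Ω) [IsProbabilityMeasure P]
    (t σ : ℕ → Ω → ℝ) (hQ : GIGI1.IsStableQueue P t σ)
    (hIRV : GIGI1.IsIRV (P.map (σ 0))) :
    -- the mean number of customers served in a busy period is finite
    (∫⁻ ω, (GIGI1.numServed t σ ω : ℝ≥0∞) ∂P < ∞) ∧
    -- tail asymptotics of the busy period, and the value of the series
    ((fun x : ℝ => P.real {ω | (x : EReal) < GIGI1.busyPeriod t σ ω}) ~[atTop]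
      (fun x : ℝ => ∑' n : ℕ, P.real {ω | ((n + 1 : ℕ) : ℕ∞) ≤ GIGI1.numServed t σ ω} *
        P.real {ω | x * (1 - GIGI1.rho P t σ) < σ n ω})) ∧
    (∀ x : ℝ, HasSum
      (fun n : ℕ => P.real {ω | ((n + 1 : ℕ) : ℕ∞) ≤ GIGI1.numServed t σ ω} *
        P.real {ω | x * (1 - GIGI1.rho P t σ) < σ n ω})
      ((∫⁻ ω, (GIGI1.numServed t σ ω : ℝ≥0∞) ∂P).toReal *
        P.real {ω | x * (1 - GIGI1.rho P t σ) < σ 0 ω})) ∧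
    -- truncation to finitely many customers
    (∀ ε : ℝ, 0 < ε → ε < 1 → ∃ N : ℕ, 1 ≤ N ∧
      GIGI1.AsympGE
        (fun x : ℝ => P.real {ω | (x : EReal) < GIGI1.busyPeriod t σ ω})
        (fun x : ℝ => ∑ n ∈ Finset.range N,
          P.real {ω | ((n + 1 : ℕ) : ℕ∞) ≤ GIGI1.numServed t σ ω ∧
            x * (1 - GIGI1.rho P t σ) ≤ σ n ω}) ∧
      GIGI1.AsympGE
        (fun x : ℝ => ∑ n ∈ Finset.range N,
          P.real {ω | ((n + 1 : ℕ) : ℕ∞) ≤ GIGI1.numServed t σ ω ∧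
            x * (1 - GIGI1.rho P t σ) ≤ σ n ω})
        (fun x : ℝ => (1 - ε) * P.real {ω | (x : EReal) < GIGI1.busyPeriod t σ ω})) ∧
    -- the principle of a single big jump
    GIGI1.EventEquiv P
      (fun x : ℝ => {ω | (x : EReal) < GIGI1.busyPeriod t σ ω})
      (fun x : ℝ => ⋃ n : ℕ, {ω | ((n + 1 : ℕ) : ℕ∞) ≤ GIGI1.numServed t σ ω ∧
        x * (1 - GIGI1.rho P t σ) < σ n ω}) := by
  have hmap := hQ.isProbabilityMeasure_map
  set H := GIGI1.tail (P.map (σ 0)) with hH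
  set c := 1 - GIGI1.rho P t σ with hc
  set p : ℕ → ℝ := fun n => P.real {ω | ((n + 1 : ℕ) : ℕ∞) ≤ GIGI1.numServed t σ ω} with hp
  set m := ∑' n, p n with hm
  have hm1 : 1 ≤ m := hQ.one_le_tsum_served
  have hm0 : m ≠ 0 := by linarith
  have hH0 : ∀ y, H y ≠ 0 := fun y => (hIRV.1 y).ne'
  have htail : ∀ n y, P.real {ω | y < σ n ω} = H y := hQ.tail_eq
  have hmean : ∫⁻ ω, (GIGI1.numServed t σ ω : ℝ≥0∞) ∂P = ENNReal.ofReal m :=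
    hQ.lintegral_numServed_eq_ofReal
  have hA : Tendsto (fun x => P.real (GIGI1.longBusy t σ x) / H (c * x)) atTop (𝓝 m) :=
    hQ.longBusy_div_tendsto hIRV
  have hAO : (fun x => H (c * x)) =O[atTop] fun x => P.real (GIGI1.longBusy t σ x) :=
    isBigO_of_div_tendsto_nhds_of_ne_zero hA hm0
  refine ⟨by rw [hmean]; exact ENNReal.ofReal_lt_top, ?_, fun x => ?_, fun ε hε hε1 => ?_, ?_⟩
  · simp only [htail, tsum_mul_right, mul_comm _ c]
    refine (isEquivalent_iff_tendsto_one (Eventually.of_forall fun x => ?_)).2 ?_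
    · exact mul_ne_zero hm0 (hH0 _)
    · have h1 := hA.div_const m
      rw [div_self hm0] at h1
      refine h1.congr fun x => ?_
      rw [Pi.div_apply, div_div, mul_comm m]
      rfl
  · simp only [htail, hmean, ENNReal.toReal_ofReal (zero_le_one.trans hm1)]
    exact hQ.summable_served.hasSum.mul_right _
  · -- a partial sum of the series for the mean number of customers, close to the mean
    obtain ⟨N, hN, hN1⟩ := ((hQ.summable_served.hasSum.tendsto_sum_nat.eventually
      (lt_mem_nhds (show (1 - ε) * m < m by nlinarith))).and (eventually_ge_atTop 1)).exists
    set s := ∑ n ∈ Finset.range N, p n with hs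
    have hεm : 0 < (1 - ε) * m := mul_pos (by linarith) (by linarith)
    have hs0 : 0 < s := hεm.trans hN
    have hsm : s ≤ m := hQ.summable_served.sum_le_tsum _ fun _ _ => measureReal_nonneg
    have hg : Tendsto (fun x : ℝ => (∑ n ∈ Finset.range N,
        P.real {ω | ((n + 1 : ℕ) : ℕ∞) ≤ GIGI1.numServed t σ ω ∧ x * c ≤ σ n ω}) / H (c * x))
        atTop (𝓝 s) := by
      have h1 := ((hQ.tendsto_prob_ge_div hIRV).comp hQ.tendsto_mul_one_sub_rho).const_mul s
      rw [mul_one] at h1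
      refine h1.congr fun x => ?_
      have h2 : ∀ n, P.real {ω | ((n + 1 : ℕ) : ℕ∞) ≤ GIGI1.numServed t σ ω ∧ x * c ≤ σ n ω} =
          p n * P.real {ω | c * x ≤ σ 0 ω} := fun n => by
        rw [mul_comm x c]
        refine (hQ.prob_served_inter n (E := Set.Ici (c * x)) measurableSet_Ici).trans ?_
        congr 1
        exact congrArg ENNReal.toReal ((hQ.identDistrib_σ n).measure_mem_eq measurableSet_Ici)
      simp only [h2, ← Finset.sum_mul]
      rw [mul_div_assoc]
      rfl
    refine ⟨N, hN1, GIGI1.asympGE_of_tendsto_div ((one_le_div hs0).2 hsm) ?_,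
      GIGI1.asympGE_of_tendsto_div ((one_le_div hεm).2 hN.le) ?_⟩
    · refine (hA.div hg hs0.ne').congr fun x => ?_
      exact div_div_div_cancel_right₀ (hH0 _) _ _
    · refine (hg.div (hA.const_mul (1 - ε)) hεm.ne').congr fun x => ?_
      rw [Pi.div_apply, ← mul_div_assoc]
      exact div_div_div_cancel_right₀ (hH0 _) _ _
  · refine ⟨hQ.prob_longBusy_ne_zero hIRV, fun x => hQ.prob_bigService_ne_zero hIRV _, ?_⟩
    simp only [mul_comm _ c]
    exact (hQ.symmDiff_isLittleO hIRV).trans_isBigO hAO
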